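/- Let $d\ge 1$, let $\Omega\subset\mathbb R^d$ be a bounded polygonal/polyhedral Lipschitz domain (only boundedness, openness and the existence of the triangulations below are used), $T>0$, $I=(0,T)$, and let $a_{ij}=a_{ji}\in L^\infty(I\times\Omega)$, $1\le i,j\le d$, satisfy $\sum_{i,j}a_{ij}(t,x)\xi_i\xi_j\ge\alpha|\xi|^2$ for all $\xi\in\mathbb R^d$ and a.e. $(t,x)\in I\times\Omega$, with some $\alpha>0$. Assume that $a_{ij}(\cdot,x)$ is continuous on $[0,T]$ for a.e. $x\in\Omega$ and that $|a_{ij}(t_1,x)-a_{ij}(t_2,x)|\le\omega(|t_1-t_2|)$ for all $t_1,t_2\in[0,T]$ and a.e. $x\in\Omega$, where $\omega:[0,T]\to[0,\infty)$ is nondecreasing, $\omega(t)t^{-3/2}$ is non-increasing on $(0,T]$, and $\int_0^T\omega(t)t^{-3/2}\,dt<\infty$. Put $a(t;u,v)=\int_\Omega\sum_{i,j}a_{ij}(t,x)\,\partial_iu\,\partial_jv\,dx$. Let $\|\cdot\|$ and $(\cdot,\cdot)$ be the norm and inner product of $L^2(\Omega)$, and fix $c,\beta,\kappa>0$. Time meshes: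 $0=t_0<t_1<\dots<t_M=T$, $I_m=(t_{m-1},t_m]$, $k_m=t_m-t_{m-1}$, $k=\max_mk_m$, $k_{\min}=\min_mk_m$, such that $k_{\min}\ge ck^\beta$, $\kappa^{-1}\le k_m/k_{m+1}\le\kappa$ for $1\le m\le M-1$, and $k\le T/4$. Space discretization: a finite conformal triangulation $\mathcal T$ of $\Omega$ into $d$-simplices (no hanging nodes; no shape regularity or quasi-uniformity is required), $r\ge1$, and $V_h$ the space of all functions in $H^1_0(\Omega)$ that are polynomials of degree at most $r$ on each $\tau\in\mathcal T$. Let $P_h:L^2(\Omega)\to V_h$ be the $L^2$-orthogonal projection, let $A_h(t):V_h\to V_h$ be defined by $(A_h(t)v,\chi)=a(t;v,\chi)$ for all $\chi\in V_h$, and put $A_{kh,m}=\frac1{k_m}\int_{I_m}A_h(t)\,dt$. Fully discrete solution: given $f\in L^\infty(I;L^2(\Omega))$ and $u_0\in L^2(\Omega)$, $u_{kh}$ is the function of $t$ with constant value $u_{kh,m}\in V_h$ on each $I_m$ such that, for all functions $\varphi$ with constant value $\varphi_m\in V_h$ on each $I_m$, $$\int_0^Ta(t;u_{kh},\varphi)\,dt+\sum_{m=2}^M(u_{kh,m}-u_{kh,m-1},\varphi_m)+(u_{kh,1},\varphi_1)=\int_0^T(f,\varphi)\,dt+(u_0,\varphi_1).$$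 Write $[u_{kh}]_{m-1}=u_{kh,m}-u_{kh,m-1}$ for $1\le m\le M$, where $u_{kh,0}:=P_hu_0$. Theorem. There exist constants $\mu,\delta_0,C>0$, independent of the time mesh (subject to the above conditions with the given $c,\beta,\kappa$), of $\mathcal T$ and $r$, and of $f$ and $u_0$, such that whenever $k-k_{\min}\le\delta_0$, $$\max_{1\le m\le M}\left(\|A_{kh,m}u_{kh,m}\|+\left\|\frac{[u_{kh}]_{m-1}}{k_m}\right\|\right)\le Ce^{\mu T}\left(\ln\frac Tk\,\|f\|_{L^\infty(I;L^2(\Omega))}+\mu T\max_{1\le m\le M}\|A_{kh,m}P_hu_0\|\right).$$ -/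

import Mathlib

open MeasureTheory Set
open scoped ENNReal ContDiff

noncomputable section

namespace ParabolicFEM

/-- The space `ℝ^d` with its Euclidean norm. -/
abbrev Pt (d : ℕ) : Type := EuclideanSpace ℝ (Fin d)

/-- `L²(Ω)`. -/
abbrev L2 {d : ℕ} (Ω : Set (Pt d)) : Type := Lp ℝ 2 (volume.restrict Ω)

/-- `L²(Ω)^d`, the space of square integrable vector fields. -/
abbrev L2vec {d : ℕ} (Ω : Set (Pt d)) : Type := Lp (Pt d) 2 (volume.restrict Ω)

/-! ### The Sobolev space `H¹₀(Ω)` -/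

/-- `φ ∈ C_c^∞(Ω)`. -/
def IsTestFunction {d : ℕ} (Ω : Set (Pt d)) (φ : Pt d → ℝ) : Prop :=
  ContDiff ℝ ∞ φ ∧ HasCompactSupport φ ∧ tsupport φ ⊆ Ω

theorem gradient_add_apply {d : ℕ} {φ ψ : Pt d → ℝ} (hφ : ContDiff ℝ ∞ φ) (hψ : ContDiff ℝ ∞ ψ)
    (x : Pt d) : gradient (fun y => φ y + ψ y) x = gradient φ x + gradient ψ x := by
  have h1 : DifferentiableAt ℝ φ x := (hφ.differentiable (by simp)).differentiableAt
  have h2 : DifferentiableAt ℝ ψ x := (hψ.differentiable (by simp)).differentiableAt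
  simp only [gradient]
  rw [fderiv_fun_add h1 h2, map_add]

theorem gradient_smul_apply {d : ℕ} {φ : Pt d → ℝ} (c : ℝ) (hφ : ContDiff ℝ ∞ φ)
    (x : Pt d) : gradient (fun y => c * φ y) x = c • gradient φ x := by
  have h1 : DifferentiableAt ℝ φ x := (hφ.differentiable (by simp)).differentiableAt
  simp only [gradient]
  rw [fderiv_const_mul h1, map_smulₛₗ]
  simp

/-- All pairs `(φ, ∇φ)` with `φ ∈ C_c^∞(Ω)`, as a subspace of `L²(Ω) × L²(Ω)^d`. -/
def testPairs {d : ℕ} (Ω : Set (Pt d)) : Submodule ℝ (L2 Ω × L2vec Ω) where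
  carrier := {v | ∃ φ : Pt d → ℝ, IsTestFunction Ω φ ∧
    v.1 =ᵐ[volume.restrict Ω] φ ∧ v.2 =ᵐ[volume.restrict Ω] gradient φ}
  zero_mem' := by
    refine ⟨fun _ => 0, ⟨contDiff_const, HasCompactSupport.zero, ?_⟩, ?_, ?_⟩
    · have h : tsupport (fun _ : Pt d => (0 : ℝ)) = ∅ := by
        rw [tsupport_eq_empty_iff]; rfl
      rw [h]; exact empty_subset _
    · exact Lp.coeFn_zero _ _ _
    · have h : gradient (fun _ : Pt d => (0 : ℝ)) = 0 := by
        ext1 x; simp [gradient]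
      rw [h]; exact Lp.coeFn_zero _ _ _
  add_mem' := by
    rintro v w ⟨φ, ⟨hφ, hφc, hφs⟩, hv1, hv2⟩ ⟨ψ, ⟨hψ, hψc, hψs⟩, hw1, hw2⟩
    refine ⟨fun y => φ y + ψ y, ⟨hφ.add hψ, hφc.add hψc,
      (tsupport_add φ ψ).trans (union_subset hφs hψs)⟩, ?_, ?_⟩
    · filter_upwards [Lp.coeFn_add v.1 w.1, hv1, hw1] with x h h1 h2
      simpa [h1, h2] using h
    · filter_upwards [Lp.coeFn_add v.2 w.2, hv2, hw2] with x h h1 h2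
      rw [gradient_add_apply hφ hψ, ← h1, ← h2]
      simpa using h
  smul_mem' := by
    rintro c v ⟨φ, ⟨hφ, hφc, hφs⟩, hv1, hv2⟩
    refine ⟨fun y => c * φ y, ⟨contDiff_const.mul hφ, hφc.mul_left,
      (tsupport_mul_subset_right).trans hφs⟩, ?_, ?_⟩
    · filter_upwards [Lp.coeFn_smul c v.1, hv1] with x h h1
      simpa [h1] using h
    · filter_upwards [Lp.coeFn_smul c v.2, hv2] with x h h1
      rw [gradient_smul_apply c hφ, ← h1]
      simpa using h

/-- `H¹₀(Ω)`, the closure of `C_c^∞(Ω)` in the `H¹` norm. A function `v ∈ H¹₀(Ω)` is represented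
by the pair `(v, ∇v) ∈ L²(Ω) × L²(Ω)^d`; its weak gradient `∇v` is determined by `v`. -/
def H10 {d : ℕ} (Ω : Set (Pt d)) : Submodule ℝ (L2 Ω × L2vec Ω) :=
  (testPairs Ω).topologicalClosure

/-! ### The coefficients -/

/-- The assumptions on the coefficients `a i j t x = a_{ij}(t,x)` of the operator
`A(t) u = - ∑_{i,j} ∂_j (a_{ij}(t,·) ∂_i u)` on `(0,T) × Ω`, with ellipticity constant `α` and
modulus of continuity `η` in time. -/
structure CoefficientAssumptions {d : ℕ} (Ω : Set (Pt d)) (T α : ℝ) (η : ℝ → ℝ)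
    (a : Fin d → Fin d → ℝ → Pt d → ℝ) : Prop where
  alpha_pos : 0 < α
  /-- `a_{ij} ∈ L^∞(I × Ω)` -/
  memLp_top : ∀ i j, MemLp (fun p : ℝ × Pt d => a i j p.1 p.2) ∞
    ((volume.restrict (Ioo 0 T)).prod (volume.restrict Ω))
  symmetric : ∀ i j, ∀ᵐ p : ℝ × Pt d ∂((volume.restrict (Ioo 0 T)).prod (volume.restrict Ω)),
    a i j p.1 p.2 = a j i p.1 p.2
  elliptic : ∀ᵐ p : ℝ × Pt d ∂((volume.restrict (Ioo 0 T)).prod (volume.restrict Ω)),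
    ∀ ξ : Pt d, α * ‖ξ‖ ^ 2 ≤ ∑ i, ∑ j, a i j p.1 p.2 * ξ i * ξ j
  continuous_time : ∀ i j, ∀ᵐ x ∂(volume.restrict Ω), ContinuousOn (fun t => a i j t x) (Icc 0 T)
  modulus : ∀ i j, ∀ t₁ ∈ Icc 0 T, ∀ t₂ ∈ Icc 0 T, ∀ᵐ x ∂(volume.restrict Ω),
    |a i j t₁ x - a i j t₂ x| ≤ η |t₁ - t₂|
  eta_nonneg : ∀ s ∈ Icc 0 T, 0 ≤ η s
  eta_mono : MonotoneOn η (Icc 0 T)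
  eta_div_antitone : AntitoneOn (fun s => η s / s ^ (3 / 2 : ℝ)) (Ioc 0 T)
  eta_div_integrable : IntegrableOn (fun s => η s / s ^ (3 / 2 : ℝ)) (Ioc 0 T)

/-- The bilinear form `a(t; u, v) = ∫_Ω ∑_{i,j} a_{ij}(t,x) ∂_i u(x) ∂_j v(x) dx`. -/
def formA {d : ℕ} (Ω : Set (Pt d)) (a : Fin d → Fin d → ℝ → Pt d → ℝ) (t : ℝ)
    (u v : L2 Ω × L2vec Ω) : ℝ :=
  ∫ x in Ω, ∑ i, ∑ j, a i j t x * u.2 x i * v.2 x j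

/-! ### The time mesh -/

/-- A partition `0 = t_0 < t_1 < ⋯ < t_M = T` (values `t m` with `m > M` play no role). -/
structure TimeMesh (T : ℝ) where
  M : ℕ
  t : ℕ → ℝ
  t_zero : t 0 = 0
  t_last : t M = T
  strictMono : StrictMonoOn t (Iic M)

namespace TimeMesh

variable {T : ℝ}

/-- The time step `k_m = t_m - t_{m-1}`, `1 ≤ m ≤ M`. -/
def step (S : TimeMesh T) (m : ℕ) : ℝ := S.t m - S.t (m - 1)

/-- The maximal time step `k`. -/
def kmax (S : TimeMesh T) : ℝ := ⨆ m : Icc 1 S.M, S.step m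

/-- The minimal time step `k_min`. -/
def kmin (S : TimeMesh T) : ℝ := ⨅ m : Icc 1 S.M, S.step m

/-- The conditions on the time mesh, with constants `c`, `β`, `κ`. -/
structure Admissible (S : TimeMesh T) (c β κ : ℝ) : Prop where
  kmin_ge : c * S.kmax ^ β ≤ S.kmin
  ratio : ∀ m : ℕ, 1 ≤ m → m ≤ S.M - 1 →
    κ⁻¹ ≤ S.step m / S.step (m + 1) ∧ S.step m / S.step (m + 1) ≤ κ
  kmax_le : S.kmax ≤ T / 4

/-- `v` is constant on each interval `I_m = (t_{m-1}, t_m]`; its value on `I_m` is then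
`v_m = v (t_m)`. -/
def PiecewiseConst (S : TimeMesh T) {V : Type*} (v : ℝ → V) : Prop :=
  ∀ m ∈ Icc 1 S.M, ∀ s ∈ Ioc (S.t (m - 1)) (S.t m), v s = v (S.t m)

end TimeMesh

/-! ### The finite element space -/

/-- `K` is a conformal (no hanging nodes) triangulation of `Ω`: a finite geometric simplicial
complex, all of whose maximal simplices have dimension `d`, and whose union is the closure of `Ω`.
The elements `τ` of the triangulation are the convex hulls of the faces with `d + 1` vertices. No
shape regularity is required. -/
structure IsTriangulation {d : ℕ} (Ω : Set (Pt d)) (K : Geometry.SimplicialComplex ℝ (Pt d)) :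
    Prop where
  finite : K.faces.Finite
  pure : ∀ s ∈ K.faces, ∃ s' ∈ K.faces, s ⊆ s' ∧ s'.card = d + 1
  space_eq : K.space = closure Ω

/-- `V_h`: all functions in `H¹₀(Ω)` that coincide on each element `τ` of the triangulation with a
polynomial of degree at most `r`. -/
def femSpace {d : ℕ} (Ω : Set (Pt d)) (K : Geometry.SimplicialComplex ℝ (Pt d)) (r : ℕ) :
    Submodule ℝ (L2 Ω × L2vec Ω) where
  carrier := {v | v ∈ H10 Ω ∧ ∀ s ∈ K.faces, s.card = d + 1 →
    ∃ p : MvPolynomial (Fin d) ℝ, p.totalDegree ≤ r ∧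
      ∀ᵐ x ∂((volume.restrict Ω).restrict (convexHull ℝ (s : Set (Pt d)))),
        v.1 x = MvPolynomial.eval (fun i => x i) p}
  zero_mem' := by
    refine ⟨zero_mem _, fun s _ _ => ⟨0, by simp, ?_⟩⟩
    have h := ae_restrict_of_ae (s := convexHull ℝ (s : Set (Pt d)))
      (Lp.coeFn_zero ℝ 2 (volume.restrict Ω))
    filter_upwards [h] with x hx
    simpa using hx
  add_mem' := by
    rintro v w ⟨hv, hv'⟩ ⟨hw, hw'⟩
    refine ⟨add_mem hv hw, fun s hs hc => ?_⟩
    obtain ⟨p, hp, hpv⟩ := hv' s hs hc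
    obtain ⟨q, hq, hqw⟩ := hw' s hs hc
    refine ⟨p + q, (MvPolynomial.totalDegree_add p q).trans (max_le hp hq), ?_⟩
    have h := ae_restrict_of_ae (s := convexHull ℝ (s : Set (Pt d))) (Lp.coeFn_add v.1 w.1)
    filter_upwards [h, hpv, hqw] with x h h1 h2
    rw [map_add, ← h1, ← h2]
    simpa using h
  smul_mem' := by
    rintro c v ⟨hv, hv'⟩
    refine ⟨Submodule.smul_mem _ c hv, fun s hs hc => ?_⟩
    obtain ⟨p, hp, hpv⟩ := hv' s hs hc
    refine ⟨c • p, (MvPolynomial.totalDegree_smul_le c p).trans hp, ?_⟩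
    have h := ae_restrict_of_ae (s := convexHull ℝ (s : Set (Pt d))) (Lp.coeFn_smul c v.1)
    filter_upwards [h, hpv] with x h h1
    rw [MvPolynomial.smul_eval, ← h1]
    simpa using h

/-! ### Discrete operators

In this part `V` is a subspace of `L²(Ω) × L²(Ω)^d` that consists of pairs `(v, ∇v)`; it will be
the finite element space `V_h`. -/

open Classical in
/-- The element `w ∈ V` with `(w, χ)_Ω = ℓ χ` for all `χ ∈ V`. (It exists and is unique when
`V` is the finite element space and `ℓ` is linear.) -/
def represent {d : ℕ} {Ω : Set (Pt d)} (V : Submodule ℝ (L2 Ω × L2vec Ω)) (ℓ : V → ℝ) : V :=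
  if h : ∃ w : V, ∀ χ : V, inner ℝ w.1.1 χ.1.1 = ℓ χ then h.choose else 0

/-- The `L²` projection `P_h`: `(P_h u, χ)_Ω = (u, χ)_Ω` for all `χ ∈ V`. -/
def projL2 {d : ℕ} {Ω : Set (Pt d)} (V : Submodule ℝ (L2 Ω × L2vec Ω)) (u : L2 Ω) : V :=
  represent V fun χ => inner ℝ u χ.1.1

/-- The operator `A_h(t) : V → V` with `(A_h(t) v, χ)_Ω = a(t; v, χ)` for all `χ ∈ V`. -/
def opA {d : ℕ} {Ω : Set (Pt d)} (V : Submodule ℝ (L2 Ω × L2vec Ω))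
    (a : Fin d → Fin d → ℝ → Pt d → ℝ) (t : ℝ) (v : V) : V :=
  represent V fun χ => formA Ω a t v.1 χ.1

/-- The averaged operator `A_{kh,m} = k_m⁻¹ ∫_{I_m} A_h(t) dt`. -/
def opAvg {d : ℕ} {Ω : Set (Pt d)} (V : Submodule ℝ (L2 Ω × L2vec Ω))
    (a : Fin d → Fin d → ℝ → Pt d → ℝ) {T : ℝ} (S : TimeMesh T) (m : ℕ) (v : V) : V :=
  (S.step m)⁻¹ • ∫ t in (S.t (m - 1))..(S.t m), opA V a t v

/-! ### The fully discrete problem -/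

/-- The space-time form `B` on piecewise constant functions in time (for which the terms with
`∂_t` vanish):
`B(u, φ) = (a_{ij} ∂_i u, ∂_j φ)_{I × Ω} + ∑_{m=2}^M ([u]_{m-1}, φ_m)_Ω + (u_1, φ_1)_Ω`. -/
def formB {d : ℕ} {Ω : Set (Pt d)} (V : Submodule ℝ (L2 Ω × L2vec Ω))
    (a : Fin d → Fin d → ℝ → Pt d → ℝ) {T : ℝ} (S : TimeMesh T) (u φ : ℝ → V) : ℝ :=
  (∫ t in (0 : ℝ)..T, formA Ω a t (u t).1 (φ t).1)
    + ∑ m ∈ Finset.Icc 2 S.M,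
        inner ℝ ((u (S.t m)).1.1 - (u (S.t (m - 1))).1.1) (φ (S.t m)).1.1
    + inner ℝ (u (S.t 1)).1.1 (φ (S.t 1)).1.1

/-- `u` is a fully discrete dG(0)cG(r) solution: it belongs to the space of functions
that are piecewise constant in time with values in `V`, and
`B(u, φ) = (f, φ)_{I × Ω} + (u_0, φ_1)_Ω` for all `φ` in that space. -/
def IsDiscreteSolution {d : ℕ} {Ω : Set (Pt d)} (V : Submodule ℝ (L2 Ω × L2vec Ω))
    (a : Fin d → Fin d → ℝ → Pt d → ℝ) {T : ℝ} (S : TimeMesh T)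
    (f : ℝ → L2 Ω) (u₀ : L2 Ω) (u : ℝ → V) : Prop :=
  S.PiecewiseConst u ∧ ∀ φ : ℝ → V, S.PiecewiseConst φ →
    formB V a S u φ =
      (∫ t in (0 : ℝ)..T, inner ℝ (f t) (φ t).1.1) + inner ℝ u₀ (φ (S.t 1)).1.1

/-- The jump `[u]_{m-1} = u_m - u_{m-1}`, `1 ≤ m ≤ M`, with the value `P_h u_0` to the left of
`t_0 = 0`. -/
def jump {d : ℕ} {Ω : Set (Pt d)} (V : Submodule ℝ (L2 Ω × L2vec Ω)) {T : ℝ} (S : TimeMesh T)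
    (u₀ : L2 Ω) (u : ℝ → V) (m : ℕ) : V :=
  u (S.t m) - if m = 1 then projL2 V u₀ else u (S.t (m - 1))

end ParabolicFEM

end

/-! In operator form the scheme is an implicit Euler method `u_{j+1} + k_j A_j u_{j+1} = u_j + k_j
f_j` on `V_h` with the `L²` inner product, where `A_j` is the averaged operator and `f_j` the
projected average of `f` on the interval from `t_j` to `t_{j+1}`. Take the index `N` at which `X =
‖A_N u_{N+1}‖` is largest and freeze the operator there: the steps up to `N` become Euler steps for
`A_N` with right-hand side `f_j + p_j`, `p_j = (A_N - A_j) u_{j+1}`.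

Diagonalizing `A_N` gives a discrete Duhamel formula for `A_N u_{N+1}`. Write `s = t_{N+1} - t_j`.
The operator `A_N ∏ (1 + k_i A_N)⁻¹` over the steps from `t_j` to `t_{N+1}` has norm at most `1/s`,
so the data `f_j` contribute a logarithm (`sum_step_div_le_log`). The perturbation `p_j` is
controlled only in the dual of the energy norm of `A_N`, with size `η(s)` times the energy norm of
`u_{j+1}`. This costs half a power of `A_N`, hence the kernel `s^(-3/2)` (`pow_three_le_prod_sq`,
`norm_sq_diagOp_le_of_energy`) and the integral of `η s^(-3/2)` (`sum_antitone_le_integral`).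

The energy norm of `u_{j+1}` is at most `√(X ‖u_{j+1}‖)`. Weighted Young absorbs `X/2` into the left
side and leaves a multiple of `max ‖u_j‖`, which `L²` stability and the Poincaré inequality bound by
the data. The estimate thus closes without a Gronwall iteration (`norm_op_euler_le`). The constants
see only `d`, `α`, `κ`, `T`, the radius of `Ω` and the integral of `η s^(-3/2)`, and the smallest
step enters only through the logarithm; this is why no property of the triangulation matters beyond
finite dimension of `V_h`. -/

noncomputable section

namespace ParabolicFEM

open scoped RealInnerProductSpace

/-! ### Operators that are diagonal in an orthonormal basis -/

section Diagonal

variable {ι H : Type*} [Fintype ι] [NormedAddCommGroup H] [InnerProductSpace ℝ H]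

/-- The operator with eigenvectors `b i` and eigenvalues `c i`. -/
def diagOp (b : OrthonormalBasis ι ℝ H) (c : ι → ℝ) (v : H) : H :=
  ∑ i, (c i * ⟪b i, v⟫) • b i

theorem inner_diagOp (b : OrthonormalBasis ι ℝ H) (c : ι → ℝ) (v : H) (i : ι) :
    ⟪b i, diagOp b c v⟫ = c i * ⟪b i, v⟫ := by
  classical
  simp [diagOp, inner_sum, inner_smul_right, b.inner_eq_ite]

theorem ext_inner_basis (b : OrthonormalBasis ι ℝ H) {v w : H}
    (h : ∀ i, ⟪b i, v⟫ = ⟪b i, w⟫) : v = w := by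
  apply b.repr.injective
  ext i
  simpa [b.repr_apply_apply] using h i

theorem sum_sq_inner (b : OrthonormalBasis ι ℝ H) (v : H) :
    ∑ i, ⟪b i, v⟫ ^ 2 = ‖v‖ ^ 2 := by
  simpa [Real.norm_eq_abs, sq_abs] using b.sum_sq_norm_inner_right v

theorem norm_diagOp_le (b : OrthonormalBasis ι ℝ H) {c : ι → ℝ} {K : ℝ} (hK : 0 ≤ K)
    (hc : ∀ i, |c i| ≤ K) (v : H) : ‖diagOp b c v‖ ≤ K * ‖v‖ := by
  refine le_of_sq_le_sq ?_ (by positivity)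
  rw [← sum_sq_inner b, mul_pow, ← sum_sq_inner b v, Finset.mul_sum]
  refine Finset.sum_le_sum fun i _ => ?_
  rw [inner_diagOp, mul_pow]
  exact mul_le_mul_of_nonneg_right (sq_le_sq.2 (by rw [abs_of_nonneg hK]; exact hc i))
    (sq_nonneg _)

theorem inner_diagOp_comm (b : OrthonormalBasis ι ℝ H) (c : ι → ℝ) (v w : H) :
    ⟪diagOp b c v, w⟫ = ⟪v, diagOp b c w⟫ := by
  rw [← b.sum_inner_mul_inner, ← b.sum_inner_mul_inner v]
  refine Finset.sum_congr rfl fun i _ => ?_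
  rw [inner_diagOp, real_inner_comm, inner_diagOp, real_inner_comm v]
  ring

/-- If `y` is bounded as a functional in the energy norm of the diagonal operator with eigenvalues
`l i`, then a diagonal operator `c` with `l i * c i ^ 2 ≤ q` regularizes `y`. -/
theorem norm_sq_diagOp_le_of_energy (b : OrthonormalBasis ι ℝ H) (l c : ι → ℝ) {p q : ℝ}
    (hp : 0 ≤ p) (hq : 0 ≤ q) (hlc : ∀ i, l i * c i ^ 2 ≤ q) {y : H}
    (hy : ∀ v, ⟪y, v⟫ ^ 2 ≤ p * ⟪diagOp b l v, v⟫) : ‖diagOp b c y‖ ^ 2 ≤ p * q := by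
  set w := diagOp b c y with hw
  -- Duality with the test vector `c w`: it pairs with `y` to `‖w‖²`, while its energy is at most `q
  -- ‖w‖²`.
  have h1 : ⟪y, diagOp b c w⟫ = ‖w‖ ^ 2 := by
    rw [← inner_diagOp_comm, ← hw, real_inner_self_eq_norm_sq]
  have h2 : ⟪diagOp b l (diagOp b c w), diagOp b c w⟫ ≤ q * ‖w‖ ^ 2 := by
    rw [← b.sum_inner_mul_inner, ← sum_sq_inner b w, Finset.mul_sum]
    refine Finset.sum_le_sum fun i _ => ?_
    rw [real_inner_comm, inner_diagOp, inner_diagOp]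
    have := mul_le_mul_of_nonneg_right (hlc i) (sq_nonneg ⟪b i, w⟫)
    linarith
  have h3 := hy (diagOp b c w)
  rw [h1] at h3
  have h4 : (‖w‖ ^ 2) ^ 2 ≤ p * (q * ‖w‖ ^ 2) := h3.trans (mul_le_mul_of_nonneg_left h2 hp)
  rcases (sq_nonneg ‖w‖).eq_or_lt with h | h
  · rw [← h]
    positivity
  · nlinarith

end Diagonal

/-! ### Bounds for products of resolvents -/

/-- The linear terms of the expanded product telescope. This yields the `1/s` bound for the operator
times its resolvent product. -/
theorem one_add_mul_le_prod {t : ℕ → ℝ} {x : ℝ} (hx : 0 ≤ x) {j m : ℕ} (hjm : j ≤ m)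
    (ht : ∀ i, j ≤ i → i < m → t i ≤ t (i + 1)) :
    1 + x * (t m - t j) ≤ ∏ i ∈ Finset.Ico j m, (1 + (t (i + 1) - t i) * x) := by
  induction m, hjm using Nat.le_induction with
  | base => simp
  | succ m hm ih =>
    have ih := ih fun i h1 h2 => ht i h1 (by omega)
    rw [Finset.prod_Ico_succ_top hm]
    have h1 : t j ≤ t m := by
      have : ∀ n, j ≤ n → n ≤ m → t j ≤ t n := by
        intro n hn
        induction n, hn using Nat.le_induction with
        | base => intro; rfl
        | succ n hn ih2 => intro h; exact (ih2 (by omega)).trans (ht n hn (by omega))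
      exact this m hm le_rfl
    have h2 := ht m hm (by omega)
    have h3 : 0 ≤ (t (m + 1) - t m) * x := mul_nonneg (by linarith) hx
    have h4 : 0 ≤ x * (t m - t j) := mul_nonneg hx (by linarith)
    calc 1 + x * (t (m + 1) - t j)
        ≤ (1 + x * (t m - t j)) * (1 + (t (m + 1) - t m) * x) := by nlinarith [mul_nonneg h3 h4]
      _ ≤ _ := mul_le_mul_of_nonneg_right ih (by linarith)

/-- The quadratic terms of the expanded product are products of two different steps. Comparable
neighbours keep a single step from dominating, so these terms are a fixed fraction of the squared
total length. With a single factor there is no quadratic term, hence `j + 2 ≤ m`. In the induction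
the new cross term `s q` pays for the increment `γ (2 s + q) q` because `q ≤ κ s`. -/
theorem quadratic_le_prod {t : ℕ → ℝ} {x κ : ℝ} (hx : 0 ≤ x) (hκ : 0 < κ) {j m : ℕ}
    (hjm : j + 2 ≤ m) (ht : ∀ i, j ≤ i → i < m → t i < t (i + 1))
    (hr : ∀ i, j ≤ i → i + 1 < m → t (i + 1) - t i ≤ κ * (t (i + 2) - t (i + 1)) ∧
      t (i + 2) - t (i + 1) ≤ κ * (t (i + 1) - t i)) :
    1 + x * (t m - t j) + (2 * κ + 2)⁻¹ * (x * (t m - t j)) ^ 2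
        ≤ ∏ i ∈ Finset.Ico j m, (1 + (t (i + 1) - t i) * x) := by
  have hγ : (2 * κ + 2)⁻¹ * (2 * κ + 2) = 1 := inv_mul_cancel₀ (by positivity)
  have hγ0 : 0 < (2 * κ + 2)⁻¹ := by positivity
  set γ := (2 * κ + 2)⁻¹ with hγd
  induction m, hjm using Nat.le_induction with
  | base =>
    rw [Finset.prod_Ico_succ_top (by omega), Finset.prod_Ico_succ_top (by omega)]
    obtain ⟨h1, h2⟩ := hr j le_rfl (by omega)
    have h3 := ht j le_rfl (by omega)
    have h4 := ht (j + 1) (by omega) (by omega)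
    simp only [Finset.Ico_self, Finset.prod_empty, one_mul]
    set p := t (j + 1) - t j with hp
    set q := t (j + 1 + 1) - t (j + 1) with hq
    change p ≤ κ * q at h1
    change q ≤ κ * p at h2
    have hs : t (j + 2) - t j = p + q := by simp only [hp, hq]; ring
    have h5 : γ * (p + q) ^ 2 ≤ p * q := by
      have : (p + q) ^ 2 ≤ (2 * κ + 2) * (p * q) := by
        nlinarith [mul_le_mul_of_nonneg_left h1 (show 0 ≤ p by linarith),
          mul_le_mul_of_nonneg_left h2 (show 0 ≤ q by linarith)]
      calc γ * (p + q) ^ 2 ≤ γ * ((2 * κ + 2) * (p * q)) :=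
            mul_le_mul_of_nonneg_left this hγ0.le
        _ = p * q := by rw [← mul_assoc, hγ, one_mul]
    rw [hs]
    have h6 := mul_le_mul_of_nonneg_right h5 (sq_nonneg x)
    nlinarith
  | succ m hm ih =>
    have ih := ih (fun i h1 h2 => ht i h1 (by omega)) fun i h1 h2 => hr i h1 (by omega)
    rw [Finset.prod_Ico_succ_top (by omega)]
    obtain ⟨m', rfl⟩ : ∃ m', m = m' + 1 := ⟨m - 1, by omega⟩
    obtain ⟨-, h2⟩ := hr m' (by omega) (by omega)
    have h3 := ht (m' + 1) (by omega) (by omega)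
    have h1 : t j ≤ t m' := by
      have h0 : j ≤ m' := by omega
      have : ∀ n, j ≤ n → n ≤ m' → t j ≤ t n := by
        intro n hn
        induction n, hn using Nat.le_induction with
        | base => intro; rfl
        | succ n hn ih2 => intro h; exact (ih2 (by omega)).trans (ht n hn (by omega)).le
      exact this m' h0 le_rfl
    have h2' : t (m' + 1 + 1) - t (m' + 1) ≤ κ * (t (m' + 1) - t j) :=
      h2.trans (mul_le_mul_of_nonneg_left (by linarith) hκ.le)
    set s := t (m' + 1) - t j with hs
    set q := t (m' + 1 + 1) - t (m' + 1) with hq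
    have hss : t (m' + 1 + 1) - t j = s + q := by simp only [hs, hq]; ring
    have hq0 : 0 < q := by linarith
    have h5 : γ * (2 * s + q) ≤ s := by
      have : 2 * s + q ≤ (2 * κ + 2) * s := by nlinarith
      calc γ * (2 * s + q) ≤ γ * ((2 * κ + 2) * s) := mul_le_mul_of_nonneg_left this hγ0.le
        _ = s := by rw [← mul_assoc, hγ, one_mul]
    have hs0 : 0 ≤ s := by nlinarith
    rw [hss]
    have h6 := mul_le_mul_of_nonneg_right (mul_le_mul_of_nonneg_right h5 hq0.le) (sq_nonneg x)
    have h7 : 0 ≤ γ * (x * s) ^ 2 * (q * x) := by positivity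
    calc 1 + x * (s + q) + γ * (x * (s + q)) ^ 2
        ≤ (1 + x * s + γ * (x * s) ^ 2) * (1 + q * x) := by nlinarith
      _ ≤ _ := mul_le_mul_of_nonneg_right ih (by positivity)

/-- The smoothing estimate `λ³ ∏ (1 + k_i λ)⁻² ≤ C s⁻³` for at least two factors. -/
theorem pow_three_le_prod_sq {t : ℕ → ℝ} {x κ : ℝ} (hx : 0 ≤ x) (hκ : 0 < κ) {j m : ℕ}
    (hjm : j + 2 ≤ m) (hts : t j ≤ t m) (ht : ∀ i, j ≤ i → i < m → t i < t (i + 1))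
    (hr : ∀ i, j ≤ i → i + 1 < m → t (i + 1) - t i ≤ κ * (t (i + 2) - t (i + 1)) ∧
      t (i + 2) - t (i + 1) ≤ κ * (t (i + 1) - t i)) :
    (x * (t m - t j)) ^ 3
        ≤ ((2 * κ + 2) * ∏ i ∈ Finset.Ico j m, (1 + (t (i + 1) - t i) * x)) ^ 2 := by
  have h := quadratic_le_prod hx hκ hjm ht hr
  have hy : 0 ≤ x * (t m - t j) := mul_nonneg hx (by linarith)
  set y := x * (t m - t j)
  have h1 : 1 + y ^ 2 ≤ (2 * κ + 2) * ∏ i ∈ Finset.Ico j m, (1 + (t (i + 1) - t i) * x) := by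
    refine le_trans ?_ (mul_le_mul_of_nonneg_left h (by positivity))
    rw [mul_add, mul_inv_cancel_left₀ (by positivity)]
    nlinarith [mul_nonneg hκ.le hy]
  calc y ^ 3 ≤ (1 + y ^ 2) ^ 2 := by nlinarith [sq_nonneg (y ^ 2 - y), sq_nonneg y, sq_nonneg (y-1)]
    _ ≤ _ := pow_le_pow_left₀ (by positivity) h1 2

/-- Discrete variation of constants for one eigenvalue `l`. The source of step `j` passes through
that step's own resolvent, so the products start at `j`. -/
theorem implicit_euler_scalar {k x g : ℕ → ℝ} {l : ℝ} {n : ℕ}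
    (h0 : ∀ j < n, 1 + k j * l ≠ 0)
    (h : ∀ j < n, (1 + k j * l) * x (j + 1) = x j + k j * g j) :
    x n = ∑ j ∈ Finset.range n, k j * (∏ i ∈ Finset.Ico j n, (1 + k i * l))⁻¹ * g j
      + (∏ i ∈ Finset.Ico 0 n, (1 + k i * l))⁻¹ * x 0 := by
  induction n with
  | zero => simp
  | succ n ih =>
    have ih := ih (fun j hj => h0 j (by omega)) fun j hj => h j (by omega)
    have hn := h n (by omega)
    have hn0 := h0 n (by omega)
    have e : x (n + 1) = (1 + k n * l)⁻¹ * (x n + k n * g n) := by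
      rw [← hn, inv_mul_cancel_left₀ hn0]
    rw [e, Finset.sum_range_succ, Nat.Ico_succ_singleton, Finset.prod_singleton,
      Finset.prod_Ico_succ_top (by omega), mul_add, ih, mul_add, Finset.mul_sum]
    have : ∀ j ∈ Finset.range n,
        k j * (∏ i ∈ Finset.Ico j (n + 1), (1 + k i * l))⁻¹ * g j =
        (1 + k n * l)⁻¹ * (k j * (∏ i ∈ Finset.Ico j n, (1 + k i * l))⁻¹ * g j) := by
      intro j hj
      rw [Finset.prod_Ico_succ_top (Finset.mem_range.1 hj).le, mul_inv]
      ring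
    rw [Finset.sum_congr rfl this, mul_inv]
    ring

/-! ### Implicit Euler steps with a frozen operator -/

section Frozen

variable {H : Type*} [NormedAddCommGroup H] [InnerProductSpace ℝ H]

theorem le_of_step_lt {t : ℕ → ℝ} {n : ℕ} (ht : ∀ j < n, t j < t (j + 1)) {i j : ℕ} (hij : i ≤ j)
    (hj : j ≤ n) : t i ≤ t j := by
  induction j, hij using Nat.le_induction with
  | base => rfl
  | succ j hij ih => exact (ih (by omega)).trans (ht j (by omega)).le

theorem lt_of_step_lt {t : ℕ → ℝ} {n : ℕ} (ht : ∀ j < n, t j < t (j + 1)) {i j : ℕ} (hij : i < j)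
    (hj : j ≤ n) : t i < t j :=
  (ht i (by omega)).trans_le (le_of_step_lt ht hij hj)

/-- Replacing every `A j` by `A n` moves the difference to the right-hand side as a source. In an
eigenbasis of `A n` the solution formula splits into data, perturbation and initial value, and each
part is bounded by the size of its multipliers. -/
theorem norm_op_le_of_frozen [FiniteDimensional ℝ H] {n : ℕ} {t : ℕ → ℝ} {κ F : ℝ} (hκ : 0 < κ)
    (ht : ∀ j < n + 1, t j < t (j + 1))
    (hr : ∀ i, i + 1 < n + 1 → t (i + 1) - t i ≤ κ * (t (i + 2) - t (i + 1)) ∧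
      t (i + 2) - t (i + 1) ≤ κ * (t (i + 1) - t i))
    {A : ℕ → H →ₗ[ℝ] H} (hsym : (A n).IsSymmetric) (hpos : ∀ v, 0 ≤ ⟪A n v, v⟫)
    {u f : ℕ → H}
    (hu : ∀ j < n + 1, u (j + 1) + (t (j + 1) - t j) • A j (u (j + 1))
      = u j + (t (j + 1) - t j) • f j)
    (hF : ∀ j < n + 1, ‖f j‖ ≤ F) {w : ℕ → ℝ} (hw : ∀ j < n, 0 ≤ w j)
    (hpert : ∀ j < n, ∀ v, ⟪A n (u (j + 1)) - A j (u (j + 1)), v⟫ ^ 2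
      ≤ w j ^ 2 * ⟪A n v, v⟫) :
    ‖A n (u (n + 1))‖ ≤
      (∑ j ∈ Finset.range (n + 1), (t (j + 1) - t j) / (t (n + 1) - t j)) * F
      + ∑ j ∈ Finset.range n, (t (j + 1) - t j) *
          ((2 * κ + 2) * w j / √((t (n + 1) - t j) ^ 3))
      + ‖A n (u 0)‖ := by
  set b := hsym.eigenvectorBasis rfl with hb
  set l := hsym.eigenvalues rfl with hl
  have hbl : ∀ i, A n (b i) = l i • b i := fun i => hsym.apply_eigenvectorBasis rfl i
  have hA : ∀ v, A n v = diagOp b l v := fun v => ext_inner_basis b fun i => by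
    rw [inner_diagOp, ← hsym, hbl, inner_smul_left]; simp
  have hl0 : ∀ i, 0 ≤ l i := fun i => by
    have h := hpos (b i)
    rw [hbl, inner_smul_left, real_inner_self_eq_norm_sq, b.orthonormal.1 i] at h
    simpa using h
  set k : ℕ → ℝ := fun j => t (j + 1) - t j with hk
  have hk0 : ∀ j < n + 1, 0 < k j := fun j hj => sub_pos.2 (ht j hj)
  set P : ℕ → Fin (Module.finrank ℝ H) → ℝ :=
    fun j i => ∏ m ∈ Finset.Ico j (n + 1), (1 + k m * l i) with hP
  have hP1 : ∀ j ≤ n + 1, ∀ i, 1 + l i * (t (n + 1) - t j) ≤ P j i := fun j hj i =>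
    one_add_mul_le_prod (hl0 i) hj fun m _ h2 => (ht m h2).le
  have hs0 : ∀ j < n + 1, 0 < t (n + 1) - t j := fun j hj =>
    sub_pos.2 (lt_of_step_lt ht hj le_rfl)
  have hPpos : ∀ j < n + 1, ∀ i, 1 ≤ P j i := fun j hj i =>
    le_trans (by have := mul_nonneg (hl0 i) (hs0 j hj).le; linarith) (hP1 j hj.le i)
  -- The eigenvalues of `A n` composed with the resolvents of steps `j` to `n`.
  set c : ℕ → Fin (Module.finrank ℝ H) → ℝ := fun j i => l i * (P j i)⁻¹ with hc
  have hc1 : ∀ j < n + 1, ∀ i, |c j i| ≤ (t (n + 1) - t j)⁻¹ := fun j hj i => by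
    have h1 := hPpos j hj i
    have h2 := hP1 j hj.le i
    rw [abs_of_nonneg (mul_nonneg (hl0 i) (by positivity)), ← div_eq_mul_inv, ← one_div,
      div_le_div_iff₀ (by linarith) (hs0 j hj)]
    linarith
  have hc2 : ∀ j < n, ∀ i, l i * c j i ^ 2 ≤ (2 * κ + 2) ^ 2 / (t (n + 1) - t j) ^ 3 :=
    fun j hj i => by
      have h1 := hPpos j (by omega) i
      have h2 := pow_three_le_prod_sq (m := n + 1) (j := j) (hl0 i) hκ (by omega)
        (sub_nonneg.1 (hs0 j (by omega)).le) (fun m _ h2 => ht m h2) fun m _ h2 => hr m h2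
      have h3 := hs0 j (by omega)
      have e : l i * c j i ^ 2 = l i ^ 3 / P j i ^ 2 := by
        simp only [hc]; field_simp
      rw [e, div_le_div_iff₀ (by positivity) (by positivity), ← mul_pow, ← mul_pow]
      exact h2
  set p : ℕ → H := fun j => A n (u (j + 1)) - A j (u (j + 1)) with hp
  -- The last step is unperturbed, so every perturbation that remains passes through at least two
  -- resolvents, as the cubic smoothing bound requires.
  have hpn : p n = 0 := sub_self _
  have hrep : A n (u (n + 1)) = ∑ j ∈ Finset.range (n + 1), k j • diagOp b (c j) (f j)
      + ∑ j ∈ Finset.range n, k j • diagOp b (c j) (p j)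
      + diagOp b (fun i => (P 0 i)⁻¹) (A n (u 0)) := by
    refine ext_inner_basis b fun i => ?_
    have hstep : ∀ j < n + 1, (1 + k j * l i) * ⟪b i, u (j + 1)⟫
        = ⟪b i, u j⟫ + k j * ⟪b i, f j + p j⟫ := fun j hj => by
      have h := congrArg (fun v => ⟪b i, v⟫) (hu j hj)
      simp only [inner_add_right, inner_smul_right] at h
      rw [inner_add_right, inner_sub_right, hA (u (j + 1)), inner_diagOp]
      linarith
    have hsol := implicit_euler_scalar (x := fun j => ⟪b i, u j⟫) (g := fun j => ⟪b i, f j + p j⟫)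
      (fun j hj => (by have := mul_nonneg (hk0 j hj).le (hl0 i); linarith :
        (0 : ℝ) < 1 + k j * l i).ne') hstep
    have hsum : ∑ j ∈ Finset.range n, k j • diagOp b (c j) (p j)
        = ∑ j ∈ Finset.range (n + 1), k j • diagOp b (c j) (p j) := by
      rw [Finset.sum_range_succ, hpn]; simp [diagOp]
    rw [hsum, ← Finset.sum_add_distrib, inner_add_right, inner_sum, inner_diagOp, hA, hA,
      inner_diagOp, inner_diagOp, hsol, mul_add, Finset.mul_sum]
    congr 1
    · refine Finset.sum_congr rfl fun j _ => ?_
      simp only [inner_add_right, inner_smul_right, inner_diagOp, hc, hP]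
      ring
    · ring
  rw [hrep]
  refine (norm_add_le _ _).trans (add_le_add ((norm_add_le _ _).trans (add_le_add ?_ ?_)) ?_)
  · rw [Finset.sum_mul]
    refine (norm_sum_le _ _).trans (Finset.sum_le_sum fun j hj => ?_)
    have hj := Finset.mem_range.1 hj
    have h3 := hs0 j hj
    rw [norm_smul, Real.norm_of_nonneg (hk0 j hj).le, div_eq_mul_inv, mul_assoc]
    refine mul_le_mul_of_nonneg_left ?_ (hk0 j hj).le
    exact (norm_diagOp_le b (by positivity) (hc1 j hj) _).trans
      (mul_le_mul_of_nonneg_left (hF j hj) (by positivity))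
  · refine (norm_sum_le _ _).trans (Finset.sum_le_sum fun j hj => ?_)
    have hj := Finset.mem_range.1 hj
    have h3 := hs0 j (by omega)
    rw [norm_smul, Real.norm_of_nonneg (hk0 j (by omega)).le]
    refine mul_le_mul_of_nonneg_left ?_ (hk0 j (by omega)).le
    have h4 := norm_sq_diagOp_le_of_energy b l (c j) (sq_nonneg (w j)) (by positivity)
      (hc2 j hj) (y := p j) (fun v => by simpa only [← hA] using hpert j hj v)
    have := hw j hj
    refine le_of_sq_le_sq (h4.trans_eq ?_) (by positivity)
    rw [div_pow, Real.sq_sqrt (by positivity)]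
    ring
  · refine (norm_diagOp_le b zero_le_one (fun i => ?_) _).trans_eq (one_mul _)
    have h := hPpos 0 (by omega) i
    rw [abs_of_nonneg (by positivity)]
    exact inv_le_one_of_one_le₀ h

end Frozen

/-! ### Sums over the time steps -/

/-- The last term equals `1`; the others are of the form `1 - 1/y` with `y` a ratio of consecutive
remaining lengths, and `1 - 1/y ≤ log y` telescopes. -/
theorem sum_step_div_le_log {n : ℕ} {t : ℕ → ℝ} (ht : ∀ j < n + 1, t j < t (j + 1)) :
    ∑ j ∈ Finset.range (n + 1), (t (j + 1) - t j) / (t (n + 1) - t j)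
      ≤ 1 + Real.log ((t (n + 1) - t 0) / (t (n + 1) - t n)) := by
  have hs0 : ∀ j < n + 1, 0 < t (n + 1) - t j := fun j hj =>
    sub_pos.2 (lt_of_step_lt ht hj le_rfl)
  have key : ∀ i ≤ n, ∑ j ∈ Finset.range i, (t (j + 1) - t j) / (t (n + 1) - t j)
      ≤ Real.log (t (n + 1) - t 0) - Real.log (t (n + 1) - t i) := by
    intro i hi
    induction i with
    | zero => simp
    | succ i ih =>
      have h1 := hs0 i (by omega)
      have h2 := hs0 (i + 1) (by omega)
      have h3 := Real.one_sub_inv_le_log_of_pos (div_pos h1 h2)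
      rw [Real.log_div h1.ne' h2.ne', inv_div] at h3
      rw [Finset.sum_range_succ]
      have h4 : (t (i + 1) - t i) / (t (n + 1) - t i)
          = 1 - (t (n + 1) - t (i + 1)) / (t (n + 1) - t i) := by
        field_simp; ring
      have := ih (by omega)
      linarith
  have h1 := hs0 n (by omega)
  rw [Finset.sum_range_succ, div_self h1.ne', Real.log_div (hs0 0 (by omega)).ne' h1.ne']
  linarith [key n le_rfl]

/-- A lower Riemann sum: in the reversed variable `s = t (n + 1) - t`, each term samples `φ` at the
right end of its interval. -/
theorem sum_antitone_le_integral {n : ℕ} {t : ℕ → ℝ} {T : ℝ} {φ : ℝ → ℝ}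
    (ht : ∀ j < n + 1, t j < t (j + 1)) (hT : t (n + 1) - t 0 ≤ T)
    (hφ0 : ∀ s ∈ Ioc 0 T, 0 ≤ φ s) (hφ : AntitoneOn φ (Ioc 0 T))
    (hint : IntegrableOn φ (Ioc 0 T)) :
    ∑ j ∈ Finset.range n, (t (j + 1) - t j) * φ (t (n + 1) - t j) ≤ ∫ s in Ioc 0 T, φ s := by
  have hs0 : ∀ j < n + 1, 0 < t (n + 1) - t j := fun j hj =>
    sub_pos.2 (lt_of_step_lt ht hj le_rfl)
  have hsT : ∀ j ≤ n + 1, t (n + 1) - t j ≤ T := fun j hj => by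
    linarith [le_of_step_lt ht (Nat.zero_le j) hj]
  have hii : ∀ a b, 0 < a → a ≤ b → b ≤ T → IntervalIntegrable φ volume a b := fun a b h1 h2 h3 =>
    (intervalIntegrable_iff_integrableOn_Ioc_of_le h2).2
      (hint.mono_set (Ioc_subset_Ioc h1.le h3))
  have key : ∀ i ≤ n, ∑ j ∈ Finset.range i, (t (j + 1) - t j) * φ (t (n + 1) - t j)
      ≤ ∫ s in (t (n + 1) - t i)..(t (n + 1) - t 0), φ s := by
    intro i hi
    induction i with
    | zero => simp
    | succ i ih =>
      have h1 := hs0 i (by omega)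
      have h2 := hs0 (i + 1) (by omega)
      have h3 := ht i (by omega)
      have h4 := le_of_step_lt ht (Nat.zero_le i) (by omega)
      rw [Finset.sum_range_succ, ← intervalIntegral.integral_add_adjacent_intervals
        (hii _ _ h2 (by linarith) (hsT i (by omega)))
        (hii (t (n + 1) - t i) _ h1 (by linarith) hT), add_comm]
      refine add_le_add ?_ (ih (by omega))
      calc (t (i + 1) - t i) * φ (t (n + 1) - t i)
          = ∫ _ in (t (n + 1) - t (i + 1))..(t (n + 1) - t i), φ (t (n + 1) - t i) := by
            rw [intervalIntegral.integral_const, smul_eq_mul]; ring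
        _ ≤ _ := by
            refine intervalIntegral.integral_mono_on (by linarith) (by simp)
              (hii _ _ h2 (by linarith) (hsT i (by omega))) fun s hs => ?_
            have := hsT i (by omega)
            exact hφ ⟨by linarith [hs.1], by linarith [hs.2]⟩ ⟨h1, this⟩ hs.2
  refine (key n le_rfl).trans ?_
  have h1 := hs0 n (by omega)
  rw [intervalIntegral.integral_of_le (by linarith [le_of_step_lt ht (Nat.zero_le n) (by omega)])]
  exact setIntegral_mono_set hint ((ae_restrict_iff' measurableSet_Ioc).2 (.of_forall hφ0))
    (Ioc_subset_Ioc h1.le hT).eventuallyLE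

theorem sqrt_pow_three {s : ℝ} (hs : 0 ≤ s) : √(s ^ 3) = s ^ (3 / 2 : ℝ) := by
  rw [Real.sqrt_eq_rpow, ← Real.rpow_natCast, ← Real.rpow_mul hs]
  norm_num

/-! ### Maximal regularity of the implicit Euler method for time dependent operators -/

section Euler

variable {H : Type*} [NormedAddCommGroup H] [InnerProductSpace ℝ H]

/-- Testing each step with the new value and dropping the nonnegative operator term gives `L²`
stability. -/
theorem norm_euler_le {M : ℕ} {t : ℕ → ℝ} {F : ℝ} (ht : ∀ j < M, t j < t (j + 1))
    {A : ℕ → H →ₗ[ℝ] H} (hpos : ∀ j < M, ∀ v, 0 ≤ ⟪A j v, v⟫) {u f : ℕ → H}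
    (hu : ∀ j < M, u (j + 1) + (t (j + 1) - t j) • A j (u (j + 1))
      = u j + (t (j + 1) - t j) • f j)
    (hF : ∀ j < M, ‖f j‖ ≤ F) {n : ℕ} (hn : n ≤ M) :
    ‖u n‖ ≤ ‖u 0‖ + (t n - t 0) * F := by
  induction n with
  | zero => simp
  | succ n ih =>
    have ih := ih (by omega)
    have hk := sub_pos.2 (ht n (by omega))
    have h1 := congrArg (fun v => ⟪v, u (n + 1)⟫) (hu n (by omega))
    simp only [inner_add_left, inner_smul_left, real_inner_self_eq_norm_sq] at h1
    have h2 := mul_nonneg hk.le (hpos n (by omega) (u (n + 1)))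
    have h3 : ⟪u n, u (n + 1)⟫ ≤ ‖u n‖ * ‖u (n + 1)‖ := real_inner_le_norm _ _
    have h4 : ⟪f n, u (n + 1)⟫ ≤ F * ‖u (n + 1)‖ := (real_inner_le_norm _ _).trans
      (mul_le_mul_of_nonneg_right (hF n (by omega)) (norm_nonneg _))
    have h5 := mul_le_mul_of_nonneg_left h4 hk.le
    simp only [conj_trivial] at h1
    have h6 : ‖u (n + 1)‖ ^ 2 ≤ (‖u n‖ + (t (n + 1) - t n) * F) * ‖u (n + 1)‖ := by linarith
    have hF0 : 0 ≤ F := (norm_nonneg _).trans (hF n (by omega))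
    have h7 : ‖u (n + 1)‖ ≤ ‖u n‖ + (t (n + 1) - t n) * F := by
      rcases (norm_nonneg (u (n + 1))).eq_or_lt with h | h
      · rw [← h]; positivity
      · rw [sq] at h6; exact le_of_mul_le_mul_right h6 h
    linarith

/-- Freezing at the step where `‖A j (u (j + 1))‖` is largest lets the perturbation sum be absorbed,
since all its terms are controlled by that same maximum. -/
theorem norm_op_euler_le [FiniteDimensional ℝ H] {M : ℕ} {t : ℕ → ℝ} {T κ Cp L F U k₀ : ℝ}
    {η : ℝ → ℝ} (hκ : 0 < κ) (hCp : 0 ≤ Cp) (hL : 0 ≤ L) (hk₀ : 0 < k₀)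
    (ht : ∀ j < M, t j < t (j + 1)) (ht0 : t 0 = 0) (htM : t M = T)
    (htk : ∀ j < M, k₀ ≤ t (j + 1) - t j)
    (hr : ∀ i, i + 1 < M → t (i + 1) - t i ≤ κ * (t (i + 2) - t (i + 1)) ∧
      t (i + 2) - t (i + 1) ≤ κ * (t (i + 1) - t i))
    (hη0 : ∀ s ∈ Icc 0 T, 0 ≤ η s)
    (hη : AntitoneOn (fun s => η s / s ^ (3 / 2 : ℝ)) (Ioc 0 T))
    (hηi : IntegrableOn (fun s => η s / s ^ (3 / 2 : ℝ)) (Ioc 0 T))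
    {A : ℕ → H →ₗ[ℝ] H} (hsym : ∀ j < M, (A j).IsSymmetric)
    (hcoer : ∀ j < M, ∀ v, ‖v‖ ^ 2 ≤ Cp * ⟪A j v, v⟫) (hpos : ∀ j < M, ∀ v, 0 ≤ ⟪A j v, v⟫)
    (hpert : ∀ j n, j < n → n < M → ∀ v w, ⟪A n v - A j v, w⟫ ^ 2
      ≤ (L * η (t (n + 1) - t j)) ^ 2 * (⟪A j v, v⟫ * ⟪A n w, w⟫))
    {u f : ℕ → H}
    (hu : ∀ j < M, u (j + 1) + (t (j + 1) - t j) • A j (u (j + 1))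
      = u j + (t (j + 1) - t j) • f j)
    (hF : ∀ j < M, ‖f j‖ ≤ F) (hU : ∀ j < M, ‖A j (u 0)‖ ≤ U) {Q : ℝ}
    (hQ : Q = (2 * κ + 2) * L * ∫ s in Ioc 0 T, η s / s ^ (3 / 2 : ℝ)) {n : ℕ} (hn : n < M) :
    ‖A n (u (n + 1))‖ ≤ 2 * (1 + Real.log (T / k₀)) * F + 2 * U
      + Q * (Q + 1) * (Cp * U + T * F) := by
  have hF0 : 0 ≤ F := (norm_nonneg _).trans (hF n hn)
  have hU0 : 0 ≤ U := (norm_nonneg _).trans (hU n hn)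
  have hT : 0 < T := by rw [← htM, ← ht0]; exact lt_of_step_lt ht (by omega) le_rfl
  have hφ0 : ∀ s ∈ Ioc 0 T, 0 ≤ η s / s ^ (3 / 2 : ℝ) := fun s hs =>
    div_nonneg (hη0 s ⟨hs.1.le, hs.2⟩) (Real.rpow_nonneg hs.1.le _)
  have hQ0 : 0 ≤ Q := by
    have := setIntegral_nonneg (μ := volume) measurableSet_Ioc hφ0
    rw [hQ]; positivity
  obtain ⟨N, hN, hmax⟩ := Finset.exists_max_image (Finset.range M)
    (fun j => ‖A j (u (j + 1))‖) ⟨n, Finset.mem_range.2 hn⟩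
  have hN := Finset.mem_range.1 hN
  have hmax : ∀ j < M, ‖A j (u (j + 1))‖ ≤ ‖A N (u (N + 1))‖ := fun j hj =>
    hmax j (Finset.mem_range.2 hj)
  refine (hmax n hn).trans ?_
  set X := ‖A N (u (N + 1))‖ with hX
  have hX0 : 0 ≤ X := norm_nonneg _
  have hu0 : ‖u 0‖ ≤ Cp * U := by
    have h1 := hcoer n hn (u 0)
    have h2 : ⟪A n (u 0), u 0⟫ ≤ U * ‖u 0‖ := (real_inner_le_norm _ _).trans
      (mul_le_mul_of_nonneg_right (hU n hn) (norm_nonneg _))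
    rcases (norm_nonneg (u 0)).eq_or_lt with h | h
    · rw [← h]; positivity
    · have h3 := h1.trans (mul_le_mul_of_nonneg_left h2 hCp)
      rw [sq, ← mul_assoc] at h3
      exact le_of_mul_le_mul_right h3 h
  set R := Cp * U + T * F with hR
  have hR0 : 0 ≤ R := by positivity
  have hun : ∀ j < M, ‖u (j + 1)‖ ≤ R := fun j hj => by
    have h1 := norm_euler_le ht hpos hu hF (n := j + 1) hj
    have h2 : t (j + 1) - t 0 ≤ T := by
      rw [ht0, sub_zero, ← htM]; exact le_of_step_lt ht hj le_rfl
    have := mul_le_mul_of_nonneg_right h2 hF0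
    linarith
  -- Young's inequality `√(X R) ≤ Y`, weighted so that the perturbation total `Q * Y` contains at
  -- most `X / 2`.
  set Y := X / (2 * (Q + 1)) + (Q + 1) / 2 * R with hY
  have hYn : ∀ j < M, √⟪A j (u (j + 1)), u (j + 1)⟫ ≤ Y := fun j hj => by
    refine Real.sqrt_le_iff.2 ⟨by positivity, ?_⟩
    have h1 : ⟪A j (u (j + 1)), u (j + 1)⟫ ≤ X * R := (real_inner_le_norm _ _).trans
      (mul_le_mul (hmax j hj) (hun j hj) (norm_nonneg _) hX0)
    have h2 : X * R = 4 * (X / (2 * (Q + 1))) * ((Q + 1) / 2 * R) := by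
      field_simp; ring
    rw [hY]
    nlinarith [sq_nonneg (X / (2 * (Q + 1)) - (Q + 1) / 2 * R)]
  have htN : ∀ j < N + 1, t j < t (j + 1) := fun j hj => ht j (by omega)
  have hsT : ∀ j < N + 1, t (N + 1) - t j ∈ Ioc 0 T := fun j hj => by
    have h1 := lt_of_step_lt ht hj hN
    have h2 := le_of_step_lt ht (Nat.zero_le j) (by omega)
    have h3 := le_of_step_lt ht (Nat.succ_le_of_lt hN) le_rfl
    exact ⟨by linarith, by simp only [Nat.succ_eq_add_one] at h3; linarith⟩
  have hfroz := norm_op_le_of_frozen (w := fun j => L * η (t (N + 1) - t j) * Y) hκ htN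
    (fun i hi => hr i (by omega)) (hsym N hN) (hpos N hN)
    (fun j hj => hu j (by omega)) (fun j hj => hF j (by omega))
    (fun j hj => mul_nonneg (mul_nonneg hL
      (hη0 _ (Ioc_subset_Icc_self (hsT j (by omega))))) (by positivity)) (fun j hj v => by
      refine (hpert j N hj hN _ _).trans ?_
      rw [mul_pow (_ * _) Y, mul_assoc _ (Y ^ 2)]
      have h1 := hYn j (by omega)
      have h2 : ⟪A j (u (j + 1)), u (j + 1)⟫ ≤ Y ^ 2 := (Real.sqrt_le_iff.1 h1).2
      exact mul_le_mul_of_nonneg_left (mul_le_mul_of_nonneg_right h2 (hpos N hN v))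
        (sq_nonneg _))
  have hlog : ∑ j ∈ Finset.range (N + 1), (t (j + 1) - t j) / (t (N + 1) - t j)
      ≤ 1 + Real.log (T / k₀) := by
    refine (sum_step_div_le_log htN).trans (add_le_add le_rfl (Real.log_le_log ?_ ?_))
    · exact div_pos (hsT 0 (by omega)).1 (hsT N (by omega)).1
    · exact div_le_div₀ hT.le (hsT 0 (by omega)).2 hk₀ (htk N hN)
  have hpertsum : ∑ j ∈ Finset.range N, (t (j + 1) - t j) *
      ((2 * κ + 2) * (L * η (t (N + 1) - t j) * Y) / √((t (N + 1) - t j) ^ 3)) ≤ Q * Y := by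
    have h1 := sum_antitone_le_integral htN (hsT 0 (by omega)).2 hφ0 hη hηi
    have h2 := mul_le_mul_of_nonneg_left h1 (show 0 ≤ (2 * κ + 2) * L * Y by positivity)
    rw [Finset.mul_sum] at h2
    calc _ = _ := Finset.sum_congr rfl fun j hj => by
          rw [sqrt_pow_three (hsT j (by have := Finset.mem_range.1 hj; omega)).1.le]
          ring
      _ ≤ _ := h2
      _ = Q * Y := by rw [hQ]; ring
  have hQY : Q * Y ≤ X / 2 + Q * (Q + 1) / 2 * R := by
    have : Q * (X / (2 * (Q + 1))) ≤ X / 2 := by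
      rw [mul_div_assoc', div_le_div_iff₀ (by positivity) (by norm_num)]
      nlinarith
    rw [hY, mul_add]
    linarith
  have h1 := mul_le_mul_of_nonneg_right hlog hF0
  have h2 := hU N hN
  -- The term `X / 2` is absorbed here, which doubles all the other terms.
  linarith

end Euler

/-! ### Functions in `H¹₀(Ω)` -/

section Sobolev

variable {d : ℕ} {Ω : Set (Pt d)}

theorem norm_sq_eq_integral {X E : Type*} [MeasurableSpace X] {μ : Measure X}
    [NormedAddCommGroup E] [InnerProductSpace ℝ E] (v : Lp E 2 μ) :
    ‖v‖ ^ 2 = ∫ x, ‖v x‖ ^ 2 ∂μ := by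
  rw [← real_inner_self_eq_norm_sq, L2.inner_def]
  simp only [real_inner_self_eq_norm_sq]

theorem setIntegral_eq_integral_of_ae {f g : Pt d → ℝ} (h : f =ᵐ[volume.restrict Ω] g)
    (h0 : ∀ x ∉ Ω, g x = 0) : ∫ x in Ω, f x = ∫ x, g x :=
  (integral_congr_ae h).trans (setIntegral_eq_integral_of_forall_compl_eq_zero h0)

theorem IsTestFunction.eq_zero {φ : Pt d → ℝ} (hφ : IsTestFunction Ω φ) {x : Pt d} (hx : x ∉ Ω) :
    φ x = 0 :=
  image_eq_zero_of_notMem_tsupport fun h => hx (hφ.2.2 h)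

theorem IsTestFunction.fderiv_eq_zero {φ : Pt d → ℝ} (hφ : IsTestFunction Ω φ) {x : Pt d}
    (hx : x ∉ Ω) : fderiv ℝ φ x = 0 :=
  image_eq_zero_of_notMem_tsupport fun h => hx (hφ.2.2 (tsupport_fderiv_subset ℝ h))

theorem gradient_eq_zero_of_fderiv {φ : Pt d → ℝ} {x : Pt d} (h : fderiv ℝ φ x = 0) :
    gradient φ x = 0 := by
  rw [gradient, h, map_zero]

theorem IsTestFunction.continuous_gradient {φ : Pt d → ℝ} (hφ : IsTestFunction Ω φ) :
    Continuous (gradient φ) :=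
  (InnerProductSpace.toDual ℝ (Pt d)).symm.continuous.comp (hφ.1.continuous_fderiv (by simp))

theorem IsTestFunction.hasCompactSupport_gradient {φ : Pt d → ℝ} (hφ : IsTestFunction Ω φ) :
    HasCompactSupport (gradient φ) :=
  (hφ.2.1.fderiv ℝ).comp_left (g := (InnerProductSpace.toDual ℝ (Pt d)).symm) (map_zero _)

theorem gradient_apply {φ : Pt d → ℝ} (x : Pt d) (i : Fin d) :
    gradient φ x i = fderiv ℝ φ x (EuclideanSpace.single i 1) := by
  have h : ⟪gradient φ x, EuclideanSpace.single i (1 : ℝ)⟫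
      = fderiv ℝ φ x (EuclideanSpace.single i 1) := by
    rw [gradient, InnerProductSpace.toDual_symm_apply]
  rw [← h, EuclideanSpace.inner_single_right]
  simp

/-- Poincaré's inequality from `1 = ∂_i x_i`: integration by parts gives `∫ φ² = -2 ∫ x_i φ ∂_i φ`,
and half of `∫ φ²` is absorbed by Young. -/
theorem IsTestFunction.integral_sq_le {φ : Pt d → ℝ} (hφ : IsTestFunction Ω φ) (hd : 1 ≤ d) {R : ℝ}
    (hR : ∀ x ∈ Ω, ‖x‖ ≤ R) :
    ∫ x, φ x ^ 2 ≤ (2 * R) ^ 2 * ∫ x, ‖gradient φ x‖ ^ 2 := by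
  set i : Fin d := ⟨0, hd⟩
  have hc := hφ.1.continuous
  have hdiff : Differentiable ℝ φ := hφ.1.differentiable (by simp)
  have hg := hφ.continuous_gradient
  have hgi : Continuous fun x => gradient φ x i :=
    (EuclideanSpace.proj (𝕜 := ℝ) i).continuous.comp hg
  have hxi : Continuous fun x : Pt d => x i := (EuclideanSpace.proj (𝕜 := ℝ) i).continuous
  have hφ2 : HasCompactSupport fun x => φ x ^ 2 :=
    hφ.2.1.comp_left (g := fun y : ℝ => y ^ 2) (by simp)
  have hf1 : ∀ x, fderiv ℝ (fun x : Pt d => x i) x (EuclideanSpace.single i 1) = 1 := fun x => by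
    have : fderiv ℝ (fun x : Pt d => x i) x = EuclideanSpace.proj (𝕜 := ℝ) i :=
      (EuclideanSpace.proj (𝕜 := ℝ) i).fderiv
    rw [this]; simp
  have hf2 : ∀ x, fderiv ℝ (fun x => φ x ^ 2) x (EuclideanSpace.single i 1)
      = 2 * φ x * gradient φ x i := fun x => by
    rw [fderiv_fun_pow _ (hdiff x), gradient_apply]
    simp [mul_assoc]
  have hint1 : Integrable fun x => φ x ^ 2 := (hc.pow 2).integrable_of_hasCompactSupport hφ2
  have hint2 : Integrable fun x => x i * (2 * φ x * gradient φ x i) := by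
    refine Continuous.integrable_of_hasCompactSupport (by fun_prop) ?_
    exact (HasCompactSupport.mul_right (hφ.2.1.mul_left (f := fun _ => (2 : ℝ)))).mul_left
  have hint3 : Integrable fun x => ‖gradient φ x‖ ^ 2 :=
    Continuous.integrable_of_hasCompactSupport (by fun_prop)
      (hφ.hasCompactSupport_gradient.comp_left (g := fun y => ‖y‖ ^ 2) (by simp))
  have hibp : ∫ x, x i * (2 * φ x * gradient φ x i) = - ∫ x, φ x ^ 2 := by
    have h := integral_mul_fderiv_eq_neg_fderiv_mul_of_integrable (μ := (volume : Measure (Pt d)))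
      (f := fun x : Pt d => x i) (g := fun x => φ x ^ 2) (v := EuclideanSpace.single i (1 : ℝ))
      (by simpa only [hf1, one_mul] using hint1) (by simpa only [hf2] using hint2)
      (Continuous.integrable_of_hasCompactSupport (by fun_prop) hφ2.mul_left)
      (fun x _ => (EuclideanSpace.proj (𝕜 := ℝ) i).differentiableAt)
      (fun x _ => (hdiff x).pow 2)
    simpa only [hf1, hf2, one_mul] using h
  have hpt : ∀ x, -(x i * (2 * φ x * gradient φ x i))
      ≤ φ x ^ 2 / 2 + 2 * R ^ 2 * ‖gradient φ x‖ ^ 2 := fun x => by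
    by_cases hx : x ∈ Ω
    · have h1 : |x i| ≤ R := (PiLp.norm_apply_le x i).trans (hR x hx)
      have h2 : |gradient φ x i| ≤ ‖gradient φ x‖ := PiLp.norm_apply_le (gradient φ x) i
      have h3 : |x i * gradient φ x i| ≤ R * ‖gradient φ x‖ := by
        rw [abs_mul]; exact mul_le_mul h1 h2 (abs_nonneg _) ((abs_nonneg _).trans h1)
      have h4 : (x i * gradient φ x i) ^ 2 ≤ (R * ‖gradient φ x‖) ^ 2 :=
        sq_le_sq.2 (h3.trans (le_abs_self _))
      nlinarith [sq_nonneg (φ x + 2 * (x i * gradient φ x i))]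
    · rw [hφ.eq_zero hx]
      simp only [mul_zero, zero_mul, neg_zero]
      positivity
  have h := integral_mono hint2.neg ((hint1.div_const 2).add (hint3.const_mul (2 * R ^ 2))) hpt
  simp only [Pi.neg_apply, Pi.add_apply] at h
  rw [integral_neg, hibp, integral_add (hint1.div_const 2) (hint3.const_mul _), integral_div,
    integral_const_mul] at h
  linarith

theorem norm_le_of_mem_H10 (hd : 1 ≤ d) {R : ℝ} (hR0 : 0 ≤ R) (hR : ∀ x ∈ Ω, ‖x‖ ≤ R)
    {v : L2 Ω × L2vec Ω} (hv : v ∈ H10 Ω) : ‖v.1‖ ≤ 2 * R * ‖v.2‖ := by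
  have hcl : IsClosed {v : L2 Ω × L2vec Ω | ‖v.1‖ ≤ 2 * R * ‖v.2‖} :=
    isClosed_le continuous_fst.norm (continuous_const.mul continuous_snd.norm)
  have hsub : (testPairs Ω : Set (L2 Ω × L2vec Ω)) ⊆ {v | ‖v.1‖ ≤ 2 * R * ‖v.2‖} := by
    rintro w ⟨φ, hφ, h1, h2⟩
    change ‖w.1‖ ≤ 2 * R * ‖w.2‖
    refine le_of_sq_le_sq ?_ (by positivity)
    have e1 : ‖w.1‖ ^ 2 = ∫ x, φ x ^ 2 := by
      rw [norm_sq_eq_integral]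
      refine setIntegral_eq_integral_of_ae ?_ fun x hx => by rw [hφ.eq_zero hx]; simp
      filter_upwards [h1] with x hx
      rw [hx, Real.norm_eq_abs, sq_abs]
    have e2 : ‖w.2‖ ^ 2 = ∫ x, ‖gradient φ x‖ ^ 2 := by
      rw [norm_sq_eq_integral]
      refine setIntegral_eq_integral_of_ae ?_ fun x hx => by
        rw [gradient_eq_zero_of_fderiv (hφ.fderiv_eq_zero hx)]; simp
      filter_upwards [h2] with x hx
      rw [hx]
    rw [mul_pow, e1, e2]
    exact hφ.integral_sq_le hd hR
  exact closure_minimal hsub hcl hv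

theorem memLp_continuous_compact {E : Type*} [NormedAddCommGroup E] {g : Pt d → E}
    (hg : Continuous g) (hgc : HasCompactSupport g) : MemLp g 2 (volume.restrict Ω) :=
  (hg.memLp_of_hasCompactSupport hgc).restrict Ω

/-- The weak gradient is characterized by integration by parts against test functions. -/
theorem integral_weak_gradient {v : L2 Ω × L2vec Ω} (hv : v ∈ H10 Ω) {ψ : Pt d → ℝ}
    (hψ : IsTestFunction Ω ψ) (i : Fin d) :
    ∫ x in Ω, ψ x * v.2 x i = - ∫ x in Ω, gradient ψ x i * v.1 x := by
  have hcψ := hψ.1.continuous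
  have hgi : Continuous fun x => gradient ψ x i :=
    (EuclideanSpace.proj (𝕜 := ℝ) i).continuous.comp hψ.continuous_gradient
  have hgc : HasCompactSupport fun x => gradient ψ x i :=
    hψ.hasCompactSupport_gradient.comp_left (g := fun y : Pt d => y i) (by simp)
  have hm1 : MemLp (fun x => gradient ψ x i) 2 (volume.restrict Ω) :=
    memLp_continuous_compact hgi hgc
  have hm2 : MemLp (fun x => EuclideanSpace.single i (ψ x)) 2 (volume.restrict Ω) := by
    have hcs : Continuous fun y : ℝ => (EuclideanSpace.single i y : Pt d) := by
      have : (fun y : ℝ => (EuclideanSpace.single i y : Pt d))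
          = fun y : ℝ => y • EuclideanSpace.single i (1 : ℝ) := by
        ext y j; simp [PiLp.single_apply]
      rw [this]; fun_prop
    exact memLp_continuous_compact (hcs.comp hcψ)
      (hψ.2.1.comp_left (g := fun y : ℝ => (EuclideanSpace.single i y : Pt d)) (by simp))
  -- Both sides of the identity are `L²` pairings with fixed functions, so it is a closed condition
  -- and need only be checked on test pairs.
  have e1 : ∀ w : L2 Ω × L2vec Ω, ∫ x in Ω, gradient ψ x i * w.1 x = ⟪hm1.toLp _, w.1⟫ :=
    fun w => by
      rw [L2.inner_def]
      refine integral_congr_ae ?_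
      filter_upwards [hm1.coeFn_toLp] with x hx
      rw [hx]; simp [mul_comm]
  have e2 : ∀ w : L2 Ω × L2vec Ω, ∫ x in Ω, ψ x * w.2 x i = ⟪hm2.toLp _, w.2⟫ := fun w => by
    rw [L2.inner_def]
    refine integral_congr_ae ?_
    filter_upwards [hm2.coeFn_toLp] with x hx
    rw [hx, EuclideanSpace.inner_single_left]; simp
  have hcl : IsClosed {w : L2 Ω × L2vec Ω |
      ∫ x in Ω, ψ x * w.2 x i = - ∫ x in Ω, gradient ψ x i * w.1 x} := by
    simp only [e1, e2]
    exact isClosed_eq (by fun_prop) (by fun_prop)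
  have hsub : (testPairs Ω : Set (L2 Ω × L2vec Ω)) ⊆ {w : L2 Ω × L2vec Ω |
      ∫ x in Ω, ψ x * w.2 x i = - ∫ x in Ω, gradient ψ x i * w.1 x} := by
    rintro w ⟨φ, hφ, h1, h2⟩
    have hcφ := hφ.1.continuous
    have hgφ : Continuous fun x => gradient φ x i :=
      (EuclideanSpace.proj (𝕜 := ℝ) i).continuous.comp hφ.continuous_gradient
    have e3 : ∫ x in Ω, ψ x * w.2 x i = ∫ x, ψ x * gradient φ x i := by
      refine setIntegral_eq_integral_of_ae ?_ fun x hx => by rw [hψ.eq_zero hx, zero_mul]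
      filter_upwards [h2] with x hx
      rw [hx]
    have e4 : ∫ x in Ω, gradient ψ x i * w.1 x = ∫ x, gradient ψ x i * φ x := by
      refine setIntegral_eq_integral_of_ae ?_ fun x hx => by rw [hφ.eq_zero hx, mul_zero]
      filter_upwards [h1] with x hx
      rw [hx]
    refine e3.trans (Eq.trans ?_ (congrArg Neg.neg e4.symm))
    simp only [gradient_apply] at hgφ hgi ⊢
    refine integral_mul_fderiv_eq_neg_fderiv_mul_of_integrable
      (Continuous.integrable_of_hasCompactSupport (by fun_prop) hφ.2.1.mul_left)
      (Continuous.integrable_of_hasCompactSupport (by fun_prop) hψ.2.1.mul_right)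
      (Continuous.integrable_of_hasCompactSupport (by fun_prop) hψ.2.1.mul_right)
      (fun x _ => (hψ.1.differentiable (by simp)) x) (fun x _ => (hφ.1.differentiable (by simp)) x)
  exact closure_minimal hsub hcl hv

/-- The fundamental lemma of the calculus of variations makes the weak gradient unique. Hence `(v,
∇v) ↦ v` is injective on `V_h`, which may then carry the `L²` inner product. -/
theorem snd_eq_zero_of_mem_H10 (hΩ : IsOpen Ω) {v : L2 Ω × L2vec Ω} (hv : v ∈ H10 Ω)
    (h0 : v.1 = 0) : v.2 = 0 := by
  have hi : ∀ i, ∀ᵐ x ∂(volume.restrict Ω), v.2 x i = 0 := fun i => by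
    rw [ae_restrict_iff' hΩ.measurableSet]
    have hmem : MemLp (fun x => v.2 x i) 2 (volume.restrict Ω) :=
      (EuclideanSpace.proj (𝕜 := ℝ) i).comp_memLp' (Lp.memLp v.2)
    have hloc : LocallyIntegrableOn (fun x => v.2 x i) Ω volume := by
      rw [locallyIntegrableOn_iff hΩ.isLocallyClosed]
      intro k hk hkc
      have : IsFiniteMeasure (volume.restrict k) :=
        isFiniteMeasure_restrict.2 hkc.measure_lt_top.ne
      have h := (hmem.restrict k)
      rw [Measure.restrict_restrict_of_subset hk] at h
      exact h.integrable (by norm_num)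
    refine hΩ.ae_eq_zero_of_integral_contDiff_smul_eq_zero hloc fun ψ h1 h2 h3 => ?_
    have h := integral_weak_gradient hv ⟨h1, h2, h3⟩ i
    have hz : ∫ x in Ω, gradient ψ x i * v.1 x = 0 := by
      rw [← integral_zero (Pt d) ℝ (μ := volume.restrict Ω)]
      refine integral_congr_ae ?_
      filter_upwards [Lp.coeFn_zero ℝ 2 (volume.restrict Ω)] with x hx
      rw [h0, hx]; simp
    rw [hz, neg_zero] at h
    rw [← h]
    refine (setIntegral_eq_integral_of_ae (.of_forall fun x => ?_) fun x hx => ?_).symm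
    · simp
    · rw [IsTestFunction.eq_zero ⟨h1, h2, h3⟩ hx, zero_smul]
  rw [Lp.eq_zero_iff_ae_eq_zero]
  filter_upwards [ae_all_iff.2 hi] with x hx
  ext i
  simpa using hx i

end Sobolev

/-! ### The finite element space has finite dimension -/

theorem memLp_eval_convexHull {d : ℕ} {Ω : Set (Pt d)} (s : Finset (Pt d))
    (p : MvPolynomial (Fin d) ℝ) :
    MemLp (fun x : Pt d => MvPolynomial.eval (fun i => x i) p) 2
      ((volume.restrict Ω).restrict (convexHull ℝ (s : Set (Pt d)))) := by
  have hc : Continuous fun x : Pt d => MvPolynomial.eval (fun i => x i) p :=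
    (MvPolynomial.continuous_eval p).comp (continuous_pi fun i =>
      (EuclideanSpace.proj (𝕜 := ℝ) i).continuous)
  have hk : IsCompact (convexHull ℝ (s : Set (Pt d))) := s.finite_toSet.isCompact_convexHull ℝ
  have hfin : IsFiniteMeasure
      ((volume.restrict Ω).restrict (convexHull ℝ (s : Set (Pt d)))) := by
    refine isFiniteMeasure_restrict.2 ?_
    exact ((Measure.restrict_apply_le _ _).trans_lt hk.measure_lt_top).ne
  obtain ⟨C, hC⟩ := hk.exists_bound_of_continuousOn hc.continuousOn
  exact MemLp.of_bound hc.aestronglyMeasurable C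
    ((ae_restrict_iff' hk.measurableSet).2 (.of_forall hC))

/-- Polynomials of degree at most `r` as square integrable functions on a simplex. -/
def polynomialLp {d : ℕ} (Ω : Set (Pt d)) (s : Finset (Pt d)) (r : ℕ) :
    MvPolynomial.restrictTotalDegree (Fin d) ℝ r →ₗ[ℝ]
      Lp ℝ 2 ((volume.restrict Ω).restrict (convexHull ℝ (s : Set (Pt d)))) where
  toFun p := (memLp_eval_convexHull s p.1).toLp _
  map_add' p q := by
    rw [← MemLp.toLp_add]
    congr 1
    ext x
    simp
  map_smul' c p := by
    rw [RingHom.id_apply, ← MemLp.toLp_const_smul]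
    congr 1
    ext x
    simp [MvPolynomial.smul_eval]

/-- A function in `V_h` is determined by its restrictions to the finitely many `d`-simplices, which
cover `Ω`, and each restriction lies in the finite-dimensional image of a polynomial space. -/
theorem finiteDimensional_femSpace {d : ℕ} {Ω : Set (Pt d)} (hΩ : IsOpen Ω)
    {K : Geometry.SimplicialComplex ℝ (Pt d)} (hK : IsTriangulation Ω K) (r : ℕ) :
    FiniteDimensional ℝ (femSpace Ω K r) := by
  have : Finite {s // s ∈ K.faces ∧ s.card = d + 1} :=
    (hK.finite.subset fun s hs => hs.1 : Set.Finite {s | s ∈ K.faces ∧ s.card = d + 1})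
  have : Fintype {s // s ∈ K.faces ∧ s.card = d + 1} := Fintype.ofFinite _
  set Φ : ∀ s : {s // s ∈ K.faces ∧ s.card = d + 1}, femSpace Ω K r →ₗ[ℝ]
      Lp ℝ 2 ((volume.restrict Ω).restrict (convexHull ℝ (s.1 : Set (Pt d)))) := fun s =>
    (LpToLpRestrictCLM (Pt d) ℝ ℝ (volume.restrict Ω) 2
        (convexHull ℝ (s.1 : Set (Pt d)))).toLinearMap ∘ₗ
      (LinearMap.fst ℝ _ _ ∘ₗ (femSpace Ω K r).subtype) with hΦ
  have hcoe : ∀ s v, Φ s v =ᵐ[(volume.restrict Ω).restrict (convexHull ℝ (s.1 : Set (Pt d)))]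
      v.1.1 := fun s v => LpToLpRestrictCLM_coeFn ℝ _ _
  have hrange : ∀ s v, Φ s v ∈ LinearMap.range (polynomialLp Ω s.1 r) := fun s v => by
    obtain ⟨p, hp, hpv⟩ := v.2.2 s.1 s.2.1 s.2.2
    refine ⟨⟨p, (MvPolynomial.mem_restrictTotalDegree _ _ _).2 hp⟩, ?_⟩
    refine Lp.ext ?_
    filter_upwards [hcoe s v, (memLp_eval_convexHull s.1 p).coeFn_toLp, hpv] with x h1 h2 h3
    rw [h1, h3, ← h2]
    rfl
  set Ψ : femSpace Ω K r →ₗ[ℝ]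
      (∀ s : {s // s ∈ K.faces ∧ s.card = d + 1}, LinearMap.range (polynomialLp Ω s.1 r)) :=
    LinearMap.pi fun s => (Φ s).codRestrict _ (hrange s) with hΨ
  refine FiniteDimensional.of_injective Ψ ?_
  rw [← LinearMap.ker_eq_bot, LinearMap.ker_eq_bot']
  intro v hv
  have hs : ∀ s : {s // s ∈ K.faces ∧ s.card = d + 1},
      ∀ᵐ x ∂(volume.restrict Ω).restrict (convexHull ℝ (s.1 : Set (Pt d))), v.1.1 x = 0 :=
    fun s => by
      have h : Φ s v = 0 := congrArg Subtype.val (congrFun hv s)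
      filter_upwards [hcoe s v, (Lp.eq_zero_iff_ae_eq_zero.1 h)] with x h1 h2
      rw [← h1, h2]; rfl
  have hcover : Ω ⊆ ⋃ s : {s // s ∈ K.faces ∧ s.card = d + 1},
      convexHull ℝ (s.1 : Set (Pt d)) := fun x hx => by
    have h : x ∈ K.space := by rw [hK.space_eq]; exact subset_closure hx
    obtain ⟨s, hs, hxs⟩ := Geometry.SimplicialComplex.mem_space_iff.1 h
    obtain ⟨s', hs', hss, hcard⟩ := hK.pure s hs
    exact mem_iUnion.2 ⟨⟨s', hs', hcard⟩, convexHull_mono (by exact_mod_cast hss) hxs⟩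
  have h1 : v.1.1 = 0 := by
    rw [Lp.eq_zero_iff_ae_eq_zero]
    have h := (ae_restrict_iUnion_iff (μ := volume.restrict Ω) _ (fun x => v.1.1 x = 0)).2 hs
    rw [Measure.restrict_restrict' hΩ.measurableSet, inter_eq_right.2 hcover] at h
    exact h
  exact Subtype.ext (Prod.ext h1 (snd_eq_zero_of_mem_H10 hΩ v.2.1 h1))

/-! ### The bilinear form at almost every time -/

section Form

variable {d : ℕ} {Ω : Set (Pt d)}

/-- The properties of the coefficients at a fixed time `t`. -/
structure RegularTime (Ω : Set (Pt d)) (α B : ℝ) (a : Fin d → Fin d → ℝ → Pt d → ℝ) (t : ℝ) :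
    Prop where
  measurable : ∀ i j, AEStronglyMeasurable (a i j t) (volume.restrict Ω)
  bounded : ∀ i j, ∀ᵐ x ∂(volume.restrict Ω), |a i j t x| ≤ B
  symmetric : ∀ i j, ∀ᵐ x ∂(volume.restrict Ω), a i j t x = a j i t x
  elliptic : ∀ᵐ x ∂(volume.restrict Ω),
    ∀ ξ : Pt d, α * ‖ξ‖ ^ 2 ≤ ∑ i, ∑ j, a i j t x * ξ i * ξ j

/-- Fubini turns almost everywhere statements in `(t, x)` into statements at almost every time. The
sum of all entrywise sup norms serves as one bound for all entries and times. -/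
theorem CoefficientAssumptions.ae_regularTime {T α : ℝ} {η : ℝ → ℝ}
    {a : Fin d → Fin d → ℝ → Pt d → ℝ} (ha : CoefficientAssumptions Ω T α η a) :
    ∃ B, 0 ≤ B ∧ ∀ᵐ t ∂(volume.restrict (Ioc 0 T)), RegularTime Ω α B a t := by
  have hb : ∀ i j, ∀ᵐ p : ℝ × Pt d ∂((volume.restrict (Ioo 0 T)).prod (volume.restrict Ω)),
      |a i j p.1 p.2| ≤ ∑ i, ∑ j, lpNorm (fun p : ℝ × Pt d => a i j p.1 p.2) ∞
        ((volume.restrict (Ioo 0 T)).prod (volume.restrict Ω)) := fun i j => by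
    filter_upwards [ae_le_lpNorm_exponent_top (ha.memLp_top i j)] with p hp
    refine hp.trans ?_
    refine le_trans ?_ (Finset.single_le_sum (f := fun i => ∑ j, lpNorm
      (fun p : ℝ × Pt d => a i j p.1 p.2) ∞ ((volume.restrict (Ioo 0 T)).prod
      (volume.restrict Ω))) (fun i _ => Finset.sum_nonneg fun j _ => lpNorm_nonneg)
      (Finset.mem_univ i))
    exact Finset.single_le_sum (f := fun j => lpNorm (fun p : ℝ × Pt d => a i j p.1 p.2) ∞
      ((volume.restrict (Ioo 0 T)).prod (volume.restrict Ω))) (fun j _ => lpNorm_nonneg)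
      (Finset.mem_univ j)
  refine ⟨∑ i, ∑ j, lpNorm (fun p : ℝ × Pt d => a i j p.1 p.2) ∞
    ((volume.restrict (Ioo 0 T)).prod (volume.restrict Ω)),
    Finset.sum_nonneg fun i _ => Finset.sum_nonneg fun j _ => lpNorm_nonneg, ?_⟩
  rw [← restrict_Ioo_eq_restrict_Ioc]
  filter_upwards [ae_all_iff.2 fun i => ae_all_iff.2 fun j =>
      (ha.memLp_top i j).aestronglyMeasurable.prodMk_left,
    ae_all_iff.2 fun i => ae_all_iff.2 fun j => Measure.ae_ae_of_ae_prod (hb i j),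
    ae_all_iff.2 fun i => ae_all_iff.2 fun j => Measure.ae_ae_of_ae_prod (ha.symmetric i j),
    Measure.ae_ae_of_ae_prod ha.elliptic] with t h1 h2 h3 h4
  exact ⟨h1, h2, h3, h4⟩

theorem memLp_coord (v : L2vec Ω) (i : Fin d) : MemLp (fun x => v x i) 2 (volume.restrict Ω) :=
  (EuclideanSpace.proj (𝕜 := ℝ) i).comp_memLp' (Lp.memLp v)

theorem integrable_coeff_mul {c : Fin d → Fin d → Pt d → ℝ} {B : ℝ}
    (hm : ∀ i j, AEStronglyMeasurable (c i j) (volume.restrict Ω))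
    (hb : ∀ i j, ∀ᵐ x ∂(volume.restrict Ω), |c i j x| ≤ B) (u v : L2vec Ω) (i j : Fin d) :
    Integrable (fun x => c i j x * u x i * v x j) (volume.restrict Ω) := by
  simp only [mul_assoc]
  exact ((memLp_coord u i).integrable_mul (memLp_coord v j)).bdd_mul (hm i j) (hb i j)

theorem integrable_sum_coeff_mul {c : Fin d → Fin d → Pt d → ℝ} {B : ℝ}
    (hm : ∀ i j, AEStronglyMeasurable (c i j) (volume.restrict Ω))
    (hb : ∀ i j, ∀ᵐ x ∂(volume.restrict Ω), |c i j x| ≤ B) (u v : L2vec Ω) :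
    Integrable (fun x => ∑ i, ∑ j, c i j x * u x i * v x j) (volume.restrict Ω) :=
  integrable_finsetSum _ fun i _ => integrable_finsetSum _ fun j _ =>
    integrable_coeff_mul hm hb u v i j

theorem integral_norm_mul_norm_le (u v : L2vec Ω) :
    Integrable (fun x => ‖u x‖ * ‖v x‖) (volume.restrict Ω) ∧
      ∫ x in Ω, ‖u x‖ * ‖v x‖ ≤ ‖u‖ * ‖v‖ := by
  have hu := (Lp.memLp u).norm
  have hv := (Lp.memLp v).norm
  refine ⟨hu.integrable_mul hv, ?_⟩
  have h := real_inner_le_norm (hu.toLp _) (hv.toLp _)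
  rw [Lp.norm_toLp, Lp.norm_toLp, eLpNorm_norm, eLpNorm_norm, ← Lp.norm_def, ← Lp.norm_def,
    L2.inner_def] at h
  refine le_trans (le_of_eq (integral_congr_ae ?_)) h
  filter_upwards [hu.coeFn_toLp, hv.coeFn_toLp] with x h1 h2
  rw [h1, h2]
  simp [mul_comm]

/-- The `d²` entries are bounded separately, and Cauchy–Schwarz does the rest. It is applied both to
`a` and to differences of `a` at two times. -/
theorem abs_integral_coeff_le {c : Fin d → Fin d → Pt d → ℝ} {B : ℝ} (hB : 0 ≤ B)
    (hb : ∀ i j, ∀ᵐ x ∂(volume.restrict Ω), |c i j x| ≤ B) (u v : L2vec Ω) :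
    |∫ x in Ω, ∑ i, ∑ j, c i j x * u x i * v x j| ≤ d ^ 2 * B * (‖u‖ * ‖v‖) := by
  obtain ⟨hint, hle⟩ := integral_norm_mul_norm_le u v
  have h := norm_integral_le_of_norm_le (μ := volume.restrict Ω)
    (f := fun x => ∑ i, ∑ j, c i j x * u x i * v x j)
    (hint.const_mul (d ^ 2 * B)) (by
      filter_upwards [ae_all_iff.2 fun i => ae_all_iff.2 fun j => hb i j] with x hx
      calc ‖∑ i, ∑ j, c i j x * u x i * v x j‖
          ≤ ∑ i : Fin d, ∑ j : Fin d, B * (‖u x‖ * ‖v x‖) := by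
            refine (norm_sum_le _ _).trans (Finset.sum_le_sum fun i _ => ?_)
            refine (norm_sum_le _ _).trans (Finset.sum_le_sum fun j _ => ?_)
            rw [norm_mul, norm_mul, mul_assoc]
            exact mul_le_mul (hx i j) (mul_le_mul (PiLp.norm_apply_le (u x) i)
              (PiLp.norm_apply_le (v x) j) (norm_nonneg _) (norm_nonneg _)) (by positivity) hB
        _ = d ^ 2 * B * (‖u x‖ * ‖v x‖) := by simp; ring)
  rw [integral_const_mul] at h
  exact h.trans (mul_le_mul_of_nonneg_left hle (by positivity))

variable {α B t : ℝ} {a : Fin d → Fin d → ℝ → Pt d → ℝ}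

theorem formA_zero_right (u : L2 Ω × L2vec Ω) : formA Ω a t u 0 = 0 := by
  rw [formA, ← integral_zero (Pt d) ℝ (μ := volume.restrict Ω)]
  refine integral_congr_ae ?_
  filter_upwards [Lp.coeFn_zero (Pt d) 2 (volume.restrict Ω)] with x hx
  simp only [Prod.snd_zero, hx]
  simp

theorem RegularTime.formA_add_right (h : RegularTime Ω α B a t) (u v w : L2 Ω × L2vec Ω) :
    formA Ω a t u (v + w) = formA Ω a t u v + formA Ω a t u w := by
  rw [formA, formA, formA, ← integral_add
    (integrable_sum_coeff_mul h.measurable h.bounded u.2 v.2)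
    (integrable_sum_coeff_mul h.measurable h.bounded u.2 w.2)]
  refine integral_congr_ae ?_
  filter_upwards [Lp.coeFn_add v.2 w.2] with x hx
  simp only [Prod.snd_add, hx, ← Finset.sum_add_distrib, Pi.add_apply, PiLp.add_apply, mul_add]

theorem formA_smul_right (c : ℝ) (u v : L2 Ω × L2vec Ω) :
    formA Ω a t u (c • v) = c * formA Ω a t u v := by
  rw [formA, formA, ← integral_const_mul]
  refine integral_congr_ae ?_
  filter_upwards [Lp.coeFn_smul c v.2] with x hx
  simp only [Prod.smul_snd, hx, Finset.mul_sum, Pi.smul_apply, PiLp.smul_apply, smul_eq_mul]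
  exact Finset.sum_congr rfl fun i _ => Finset.sum_congr rfl fun j _ => by ring

theorem RegularTime.formA_comm (h : RegularTime Ω α B a t) (u v : L2 Ω × L2vec Ω) :
    formA Ω a t u v = formA Ω a t v u := by
  rw [formA, formA]
  refine integral_congr_ae ?_
  filter_upwards [ae_all_iff.2 fun i => ae_all_iff.2 fun j => h.symmetric i j] with x hx
  rw [Finset.sum_comm]
  exact Finset.sum_congr rfl fun i _ => Finset.sum_congr rfl fun j _ => by rw [hx j i]; ring

theorem RegularTime.abs_formA_le (h : RegularTime Ω α B a t) (hB : 0 ≤ B)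
    (u v : L2 Ω × L2vec Ω) : |formA Ω a t u v| ≤ d ^ 2 * B * (‖u.2‖ * ‖v.2‖) :=
  abs_integral_coeff_le hB h.bounded u.2 v.2

theorem RegularTime.le_formA (h : RegularTime Ω α B a t) (v : L2 Ω × L2vec Ω) :
    α * ‖v.2‖ ^ 2 ≤ formA Ω a t v v := by
  rw [norm_sq_eq_integral, ← integral_const_mul]
  refine integral_mono_ae (((Lp.memLp v.2).integrable_norm_pow (by norm_num)).const_mul α)
    (integrable_sum_coeff_mul h.measurable h.bounded v.2 v.2) ?_
  filter_upwards [h.elliptic] with x hx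
  exact hx (v.2 x)

theorem abs_formA_sub_le {T : ℝ} {η : ℝ → ℝ} (ha : CoefficientAssumptions Ω T α η a) {s : ℝ}
    (ht : t ∈ Icc 0 T) (hs : s ∈ Icc 0 T) (hrt : RegularTime Ω α B a t)
    (hrs : RegularTime Ω α B a s) {b : ℝ} (hb : |t - s| ≤ b) (hbT : b ≤ T)
    (u v : L2 Ω × L2vec Ω) :
    |formA Ω a t u v - formA Ω a s u v| ≤ d ^ 2 * η b * (‖u.2‖ * ‖v.2‖) := by
  rw [formA, formA, ← integral_sub
    (integrable_sum_coeff_mul hrt.measurable hrt.bounded u.2 v.2)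
    (integrable_sum_coeff_mul hrs.measurable hrs.bounded u.2 v.2)]
  have hb0 : 0 ≤ b := (abs_nonneg _).trans hb
  have hη : η |t - s| ≤ η b := ha.eta_mono ⟨abs_nonneg _, hb.trans hbT⟩ ⟨hb0, hbT⟩ hb
  have h := abs_integral_coeff_le (c := fun i j x => a i j t x - a i j s x)
    (ha.eta_nonneg b ⟨hb0, hbT⟩) (fun i j => by
      filter_upwards [ha.modulus i j t ht s hs] with x hx
      exact hx.trans hη) u.2 v.2
  refine le_trans (le_of_eq (congrArg _ (integral_congr_ae (.of_forall fun x => ?_)))) h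
  simp only [← Finset.sum_sub_distrib, sub_mul]

/-- Measurability in `t` comes from joint measurability of the integrand by Fubini; the bound is
uniform. -/
theorem CoefficientAssumptions.integrableOn_formA {T : ℝ} {η : ℝ → ℝ}
    (ha : CoefficientAssumptions Ω T α η a) (hB : 0 ≤ B)
    (hreg : ∀ᵐ t ∂(volume.restrict (Ioc 0 T)), RegularTime Ω α B a t) (u v : L2 Ω × L2vec Ω) :
    IntegrableOn (fun t => formA Ω a t u v) (Ioc 0 T) := by
  refine Integrable.of_bound (C := d ^ 2 * B * (‖u.2‖ * ‖v.2‖)) ?_ (by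
    filter_upwards [hreg] with t ht
    exact ht.abs_formA_le hB u v)
  rw [← restrict_Ioo_eq_restrict_Ioc]
  refine AEStronglyMeasurable.integral_prod_right'
    (f := fun p : ℝ × Pt d => ∑ i, ∑ j, a i j p.1 p.2 * u.2 p.2 i * v.2 p.2 j) ?_
  refine Finset.aestronglyMeasurable_fun_sum _ fun i _ =>
    Finset.aestronglyMeasurable_fun_sum _ fun j _ => ?_
  exact ((ha.memLp_top i j).aestronglyMeasurable.mul
    (memLp_coord u.2 i).aestronglyMeasurable.comp_snd).mul
    (memLp_coord v.2 j).aestronglyMeasurable.comp_snd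

end Form

/-! ### Averages -/

/-- Applied once in each variable, it compares two averages over different intervals. -/
theorem abs_average_sub_le {g : ℝ → ℝ} {p q c δ : ℝ} (hpq : p < q)
    (hg : IntervalIntegrable g volume p q)
    (h : ∀ᵐ s ∂(volume.restrict (Ioc p q)), |g s - c| ≤ δ) :
    |(q - p)⁻¹ * (∫ s in p..q, g s) - c| ≤ δ := by
  have hqp : 0 < q - p := sub_pos.2 hpq
  have e : (q - p)⁻¹ * (∫ s in p..q, g s) - c = (q - p)⁻¹ * ∫ s in p..q, (g s - c) := by
    rw [intervalIntegral.integral_sub hg (by simp), intervalIntegral.integral_const, smul_eq_mul]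
    field_simp
  have h1 : ‖∫ s in p..q, (g s - c)‖ ≤ δ * |q - p| := by
    refine intervalIntegral.norm_integral_le_of_norm_le_const_ae ?_
    rw [uIoc_of_le hpq.le]
    exact (ae_restrict_iff' measurableSet_Ioc).1 h
  rw [e, abs_mul, abs_of_pos (inv_pos.2 hqp), inv_mul_le_iff₀ hqp, mul_comm]
  rwa [abs_of_pos hqp] at h1

/-! ### Discrete operators on the finite element space with the `L²` inner product -/

section Discrete

variable {d : ℕ} {Ω : Set (Pt d)} (V : Submodule ℝ (L2 Ω × L2vec Ω))

/-- The map `(v, ∇v) ↦ v`. -/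
def valueMap : V →ₗ[ℝ] L2 Ω := LinearMap.fst ℝ _ _ ∘ₗ V.subtype

variable {V}

/-- `V` as a subspace of `L²(Ω)`. -/
def valueEquiv (hV : Function.Injective (valueMap V)) : V ≃ₗ[ℝ] LinearMap.range (valueMap V) :=
  LinearEquiv.ofInjective (valueMap V) hV

theorem inner_valueEquiv (hV : Function.Injective (valueMap V)) (v w : V) :
    ⟪valueEquiv hV v, valueEquiv hV w⟫ = ⟪v.1.1, w.1.1⟫ := rfl

theorem inner_smul_valueEquiv (hV : Function.Injective (valueMap V)) (c : ℝ)
    (x : LinearMap.range (valueMap V)) (v : V) :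
    ⟪c • x, valueEquiv hV v⟫ = c * ⟪x, valueEquiv hV v⟫ :=
  real_inner_smul_left x.1 v.1.1 c

theorem norm_valueEquiv (hV : Function.Injective (valueMap V)) (v : V) :
    ‖valueEquiv hV v‖ = ‖v.1.1‖ := rfl

/-- Riesz representation on the image of `V` in `L²(Ω)`: for a linear functional the default value
in `represent` is never taken. -/
theorem inner_represent [FiniteDimensional ℝ V] (hV : Function.Injective (valueMap V)) {ℓ : V → ℝ}
    (hℓ : IsLinearMap ℝ ℓ) (χ : V) : ⟪(represent V ℓ).1.1, χ.1.1⟫ = ℓ χ := by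
  have h : ∃ w : V, ∀ χ : V, ⟪w.1.1, χ.1.1⟫ = ℓ χ := by
    set g : LinearMap.range (valueMap V) →L[ℝ] ℝ :=
      LinearMap.toContinuousLinearMap (hℓ.mk' ℓ ∘ₗ (valueEquiv hV).symm.toLinearMap)
    refine ⟨(valueEquiv hV).symm ((InnerProductSpace.toDual ℝ _).symm g), fun χ => ?_⟩
    rw [← inner_valueEquiv hV, LinearEquiv.apply_symm_apply,
      InnerProductSpace.toDual_symm_apply]
    simp [g]
  rw [represent, dif_pos h]
  exact h.choose_spec χ

theorem inner_projL2 [FiniteDimensional ℝ V] (hV : Function.Injective (valueMap V)) (u : L2 Ω)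
    (χ : V) : ⟪(projL2 V u).1.1, χ.1.1⟫ = ⟪u, χ.1.1⟫ :=
  inner_represent hV ⟨fun v w => by simp [inner_add_right],
    fun c v => by simp [inner_smul_right]⟩ χ

variable {α B T : ℝ} {η : ℝ → ℝ} {a : Fin d → Fin d → ℝ → Pt d → ℝ}

theorem RegularTime.inner_opA [FiniteDimensional ℝ V] (hV : Function.Injective (valueMap V))
    {t : ℝ} (h : RegularTime Ω α B a t) (v χ : V) :
    ⟪(opA V a t v).1.1, χ.1.1⟫ = formA Ω a t v.1 χ.1 :=
  inner_represent hV ⟨fun _ _ => h.formA_add_right _ _ _,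
    fun _ _ => formA_smul_right _ _ _⟩ χ

theorem integrableOn_sum_smul {ι E : Type*} [Fintype ι] [NormedAddCommGroup E] [NormedSpace ℝ E]
    {c : ι → ℝ → ℝ} {s : Set ℝ} (hc : ∀ i, IntegrableOn (c i) s) (e : ι → E) :
    IntegrableOn (fun t => ∑ i, c i t • e i) s :=
  integrable_finsetSum _ fun i _ => Integrable.smul_const (hc i) (e i)

/-- At regular times the coordinates of `opA V a t v` in an `L²`-orthonormal basis are values of the
form, so scalar integrability suffices. Without this the Bochner integral in `opAvg` could be the
default value `0`. -/
theorem CoefficientAssumptions.integrableOn_opA [FiniteDimensional ℝ V]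
    (hV : Function.Injective (valueMap V)) (ha : CoefficientAssumptions Ω T α η a) (hB : 0 ≤ B)
    (hreg : ∀ᵐ t ∂(volume.restrict (Ioc 0 T)), RegularTime Ω α B a t) (v : V) :
    IntegrableOn (fun t => opA V a t v) (Ioc 0 T) := by
  set b := stdOrthonormalBasis ℝ (LinearMap.range (valueMap V))
  set e := fun i => (valueEquiv hV).symm (b i)
  have hint : IntegrableOn (fun t => ∑ i, formA Ω a t v.1 (e i).1 • e i) (Ioc 0 T) :=
    integrableOn_sum_smul (fun i => ha.integrableOn_formA hB hreg v.1 (e i).1) e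
  refine hint.congr ?_
  filter_upwards [hreg] with t ht
  apply (valueEquiv hV).injective
  rw [map_sum]
  refine ext_inner_basis b fun i => ?_
  have he : ∀ i, valueEquiv hV (e i) = b i := fun i => LinearEquiv.apply_symm_apply _ _
  rw [inner_sum]
  have hterm : ∀ l, ⟪b i, valueEquiv hV (formA Ω a t v.1 (e l).1 • e l)⟫
      = if l = i then formA Ω a t v.1 (e l).1 else 0 := fun l => by
    rw [real_inner_comm, map_smul, ← he i, inner_smul_valueEquiv, he, he, b.inner_eq_ite]
    simp
  rw [Finset.sum_congr rfl fun l _ => hterm l, Finset.sum_ite_eq', if_pos (Finset.mem_univ i),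
    real_inner_comm, ← he i, inner_valueEquiv, ht.inner_opA hV]

theorem TimeMesh.interval_subset (S : TimeMesh T) {j : ℕ} (hj : j < S.M) :
    S.t j < S.t (j + 1) ∧ 0 ≤ S.t j ∧ S.t (j + 1) ≤ T := by
  refine ⟨S.strictMono (by simp; omega) (by simp; omega) (by omega), ?_, ?_⟩
  · rw [← S.t_zero]
    exact S.strictMono.monotoneOn (by simp) (by simp; omega) (by omega)
  · exact (S.strictMono.monotoneOn (by simp; omega) (by simp) (by omega)).trans_eq S.t_last

theorem inner_opAvg [FiniteDimensional ℝ V] (hV : Function.Injective (valueMap V))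
    (ha : CoefficientAssumptions Ω T α η a) (hB : 0 ≤ B)
    (hreg : ∀ᵐ t ∂(volume.restrict (Ioc 0 T)), RegularTime Ω α B a t) (S : TimeMesh T) {j : ℕ}
    (hj : j < S.M) (v χ : V) :
    ⟪(opAvg V a S (j + 1) v).1.1, χ.1.1⟫
      = (S.t (j + 1) - S.t j)⁻¹ * ∫ t in (S.t j)..(S.t (j + 1)), formA Ω a t v.1 χ.1 := by
  have : CompleteSpace V := FiniteDimensional.complete ℝ V
  obtain ⟨h1, h2, h3⟩ := S.interval_subset hj
  have hsub : Ioc (S.t j) (S.t (j + 1)) ⊆ Ioc 0 T := Ioc_subset_Ioc h2 h3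
  have hint : IntervalIntegrable (fun t => opA V a t v) volume (S.t j) (S.t (j + 1)) :=
    (intervalIntegrable_iff_integrableOn_Ioc_of_le h1.le).2
      ((ha.integrableOn_opA hV hB hreg v).mono_set hsub)
  set g : V →L[ℝ] ℝ := (innerSL ℝ χ.1.1).comp
    ((ContinuousLinearMap.fst ℝ (L2 Ω) (L2vec Ω)).comp V.subtypeL)
  have hg : ∀ w : V, g w = ⟪w.1.1, χ.1.1⟫ := fun w => by
    rw [real_inner_comm]; rfl
  rw [← hg, opAvg, TimeMesh.step, Nat.add_sub_cancel, map_smul,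
    ← g.intervalIntegral_comp_comm hint, smul_eq_mul]
  congr 1
  rw [intervalIntegral.integral_of_le h1.le, intervalIntegral.integral_of_le h1.le]
  refine integral_congr_ae ?_
  filter_upwards [ae_restrict_of_ae_restrict_of_subset hsub hreg] with t ht
  rw [hg, ht.inner_opA hV]

/-- The averaged operator on `V` as a subspace of `L²(Ω)`, on the interval `(t_j, t_{j+1}]`. -/
def avgOp [FiniteDimensional ℝ V] (hV : Function.Injective (valueMap V))
    (ha : CoefficientAssumptions Ω T α η a) (hB : 0 ≤ B)
    (hreg : ∀ᵐ t ∂(volume.restrict (Ioc 0 T)), RegularTime Ω α B a t) (S : TimeMesh T) {j : ℕ}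
    (hj : j < S.M) : LinearMap.range (valueMap V) →ₗ[ℝ] LinearMap.range (valueMap V) :=
  have hsub : Ioc (S.t j) (S.t (j + 1)) ⊆ Ioc 0 T :=
    Ioc_subset_Ioc (S.interval_subset hj).2.1 (S.interval_subset hj).2.2
  have hle := (S.interval_subset hj).1.le
  valueEquiv hV ∘ₗ
  { toFun := opAvg V a S (j + 1)
    map_add' := fun v w => by
      apply (valueEquiv hV).injective
      refine ext_inner_right ℝ fun z => ?_
      obtain ⟨χ, rfl⟩ := (valueEquiv hV).surjective z
      rw [map_add, inner_add_left, inner_valueEquiv, inner_valueEquiv, inner_valueEquiv,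
        inner_opAvg hV ha hB hreg S hj, inner_opAvg hV ha hB hreg S hj,
        inner_opAvg hV ha hB hreg S hj, ← mul_add, intervalIntegral.integral_of_le hle,
        intervalIntegral.integral_of_le hle, intervalIntegral.integral_of_le hle,
        ← integral_add ((ha.integrableOn_formA hB hreg _ _).mono_set hsub)
          ((ha.integrableOn_formA hB hreg _ _).mono_set hsub)]
      congr 1
      refine integral_congr_ae ?_
      filter_upwards [ae_restrict_of_ae_restrict_of_subset hsub hreg] with t ht
      -- Linearity in the first argument is transferred from the second by symmetry.
      rw [ht.formA_comm, Submodule.coe_add, ht.formA_add_right, ht.formA_comm, ht.formA_comm χ.1]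
    map_smul' := fun c v => by
      apply (valueEquiv hV).injective
      refine ext_inner_right ℝ fun z => ?_
      obtain ⟨χ, rfl⟩ := (valueEquiv hV).surjective z
      rw [RingHom.id_apply, map_smul, inner_smul_valueEquiv, inner_valueEquiv, inner_valueEquiv,
        inner_opAvg hV ha hB hreg S hj, inner_opAvg hV ha hB hreg S hj,
        mul_left_comm, intervalIntegral.integral_of_le hle,
        intervalIntegral.integral_of_le hle, ← integral_const_mul c]
      congr 1
      refine integral_congr_ae ?_
      filter_upwards [ae_restrict_of_ae_restrict_of_subset hsub hreg] with t ht
      rw [ht.formA_comm, Submodule.coe_smul, formA_smul_right, ht.formA_comm] } ∘ₗ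
  (valueEquiv hV).symm.toLinearMap

theorem avgOp_valueEquiv [FiniteDimensional ℝ V] (hV : Function.Injective (valueMap V))
    (ha : CoefficientAssumptions Ω T α η a) (hB : 0 ≤ B)
    (hreg : ∀ᵐ t ∂(volume.restrict (Ioc 0 T)), RegularTime Ω α B a t) (S : TimeMesh T) {j : ℕ}
    (hj : j < S.M) (v : V) :
    avgOp hV ha hB hreg S hj (valueEquiv hV v) = valueEquiv hV (opAvg V a S (j + 1) v) := by
  simp [avgOp]

theorem inner_avgOp [FiniteDimensional ℝ V] (hV : Function.Injective (valueMap V))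
    (ha : CoefficientAssumptions Ω T α η a) (hB : 0 ≤ B)
    (hreg : ∀ᵐ t ∂(volume.restrict (Ioc 0 T)), RegularTime Ω α B a t) (S : TimeMesh T) {j : ℕ}
    (hj : j < S.M) (v χ : V) :
    ⟪avgOp hV ha hB hreg S hj (valueEquiv hV v), valueEquiv hV χ⟫
      = (S.t (j + 1) - S.t j)⁻¹ * ∫ t in (S.t j)..(S.t (j + 1)), formA Ω a t v.1 χ.1 := by
  rw [avgOp_valueEquiv, inner_valueEquiv, inner_opAvg hV ha hB hreg S hj]

theorem isSymmetric_avgOp [FiniteDimensional ℝ V] (hV : Function.Injective (valueMap V))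
    (ha : CoefficientAssumptions Ω T α η a) (hB : 0 ≤ B)
    (hreg : ∀ᵐ t ∂(volume.restrict (Ioc 0 T)), RegularTime Ω α B a t) (S : TimeMesh T) {j : ℕ}
    (hj : j < S.M) : (avgOp hV ha hB hreg S hj).IsSymmetric := by
  intro x y
  obtain ⟨v, rfl⟩ := (valueEquiv hV).surjective x
  obtain ⟨w, rfl⟩ := (valueEquiv hV).surjective y
  rw [inner_avgOp hV, real_inner_comm, inner_avgOp hV]
  obtain ⟨h1, h2, h3⟩ := S.interval_subset hj
  rw [intervalIntegral.integral_of_le h1.le, intervalIntegral.integral_of_le h1.le]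
  congr 1
  refine integral_congr_ae ?_
  filter_upwards [ae_restrict_of_ae_restrict_of_subset (Ioc_subset_Ioc h2 h3) hreg] with t ht
  exact ht.formA_comm _ _

theorem le_inner_avgOp [FiniteDimensional ℝ V] (hV : Function.Injective (valueMap V))
    (ha : CoefficientAssumptions Ω T α η a) (hB : 0 ≤ B)
    (hreg : ∀ᵐ t ∂(volume.restrict (Ioc 0 T)), RegularTime Ω α B a t) (S : TimeMesh T) {j : ℕ}
    (hj : j < S.M) (v : V) :
    α * ‖v.1.2‖ ^ 2 ≤ ⟪avgOp hV ha hB hreg S hj (valueEquiv hV v), valueEquiv hV v⟫ := by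
  obtain ⟨h1, h2, h3⟩ := S.interval_subset hj
  have hk : 0 < S.t (j + 1) - S.t j := sub_pos.2 h1
  have hsub : Ioc (S.t j) (S.t (j + 1)) ⊆ Ioc 0 T := Ioc_subset_Ioc h2 h3
  rw [inner_avgOp hV, le_inv_mul_iff₀ hk, intervalIntegral.integral_of_le h1.le]
  calc (S.t (j + 1) - S.t j) * (α * ‖v.1.2‖ ^ 2)
      = ∫ _ in Ioc (S.t j) (S.t (j + 1)), α * ‖v.1.2‖ ^ 2 := by
        rw [← intervalIntegral.integral_of_le h1.le, intervalIntegral.integral_const, smul_eq_mul]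
    _ ≤ _ := by
        refine integral_mono_ae (integrable_const _) ((ha.integrableOn_formA hB hreg _ _).mono_set hsub) ?_
        filter_upwards [ae_restrict_of_ae_restrict_of_subset hsub hreg] with t ht
        exact ht.le_formA v.1

/-- Any two times in the two steps differ by at most `t (n + 1) - t j`, and averaging preserves the
resulting bound. -/
theorem abs_inner_avgOp_sub_le [FiniteDimensional ℝ V] (hV : Function.Injective (valueMap V))
    (ha : CoefficientAssumptions Ω T α η a) (hB : 0 ≤ B)
    (hreg : ∀ᵐ t ∂(volume.restrict (Ioc 0 T)), RegularTime Ω α B a t) (S : TimeMesh T) {j n : ℕ}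
    (hjn : j < n) (hn : n < S.M) (v w : V) :
    |⟪avgOp hV ha hB hreg S hn (valueEquiv hV v), valueEquiv hV w⟫
        - ⟪avgOp hV ha hB hreg S (hjn.trans hn) (valueEquiv hV v), valueEquiv hV w⟫|
      ≤ d ^ 2 * η (S.t (n + 1) - S.t j) * (‖v.1.2‖ * ‖w.1.2‖) := by
  have hj := hjn.trans hn
  obtain ⟨h1, h2, h3⟩ := S.interval_subset hj
  obtain ⟨h4, h5, h6⟩ := S.interval_subset hn
  have h7 : S.t (j + 1) ≤ S.t n :=
    S.strictMono.monotoneOn (by simp; omega) (by simp; omega) (by omega)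
  have hsub1 : Ioc (S.t j) (S.t (j + 1)) ⊆ Ioc 0 T := Ioc_subset_Ioc h2 h3
  have hsub2 : Ioc (S.t n) (S.t (n + 1)) ⊆ Ioc 0 T := Ioc_subset_Ioc h5 h6
  rw [inner_avgOp hV, inner_avgOp hV, abs_sub_comm]
  refine abs_average_sub_le h1 ((intervalIntegrable_iff_integrableOn_Ioc_of_le h1.le).2
    ((ha.integrableOn_formA hB hreg _ _).mono_set hsub1)) ?_
  filter_upwards [ae_restrict_of_ae_restrict_of_subset hsub1 hreg,
    ae_restrict_mem measurableSet_Ioc] with s hs hsm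
  rw [abs_sub_comm]
  refine abs_average_sub_le h4 ((intervalIntegrable_iff_integrableOn_Ioc_of_le h4.le).2
    ((ha.integrableOn_formA hB hreg _ _).mono_set hsub2)) ?_
  filter_upwards [ae_restrict_of_ae_restrict_of_subset hsub2 hreg,
    ae_restrict_mem measurableSet_Ioc] with t ht htm
  refine abs_formA_sub_le ha (Ioc_subset_Icc_self (hsub2 htm)) (Ioc_subset_Icc_self (hsub1 hsm))
    ht hs ?_ (by linarith) v.1 w.1
  rw [abs_of_nonneg] <;> linarith [hsm.1, hsm.2, htm.1, htm.2]

end Discrete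

/-! ### The time stepping scheme -/

section Scheme

variable {d : ℕ} {Ω : Set (Pt d)} {V : Submodule ℝ (L2 Ω × L2vec Ω)} {T : ℝ}
  {a : Fin d → Fin d → ℝ → Pt d → ℝ}

theorem integral_eq_of_support {p q : ℝ} (hp : 0 ≤ p) (hpq : p ≤ q) (hq : q ≤ T) {g h : ℝ → ℝ}
    (h1 : ∀ s ∈ Ioc p q, g s = h s) (h2 : ∀ s ∉ Ioc p q, g s = 0) :
    ∫ s in (0 : ℝ)..T, g s = ∫ s in p..q, h s := by
  rw [intervalIntegral.integral_of_le (by linarith), intervalIntegral.integral_of_le hpq,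
    ← setIntegral_congr_fun measurableSet_Ioc h1]
  exact setIntegral_eq_of_subset_of_forall_sdiff_eq_zero measurableSet_Ioc (Ioc_subset_Ioc hp hq)
    fun s hs => h2 s hs.2

/-- The discrete problem tested with a function supported on one time interval. -/
theorem IsDiscreteSolution.step_eq {S : TimeMesh T} {f : ℝ → L2 Ω} {u₀ : L2 Ω} {u : ℝ → V}
    (hu : IsDiscreteSolution V a S f u₀ u) {j : ℕ} (hj : j < S.M) (χ : V) :
    (∫ t in (S.t j)..(S.t (j + 1)), formA Ω a t (u (S.t (j + 1))).1 χ.1)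
      + inner ℝ (u (S.t (j + 1))).1.1 χ.1.1
      - (if j = 0 then inner ℝ u₀ χ.1.1 else inner ℝ (u (S.t j)).1.1 χ.1.1)
      = ∫ t in (S.t j)..(S.t (j + 1)), inner ℝ (f t) χ.1.1 := by
  classical
  obtain ⟨h1, h2, h3⟩ := S.interval_subset hj
  -- With this test function only one jump term survives: the separate initial term for `j = 0`, the
  -- summand `j + 1` otherwise.
  set φ : ℝ → V := fun s => if s ∈ Ioc (S.t j) (S.t (j + 1)) then χ else 0 with hφ
  have hφ1 : ∀ s ∈ Ioc (S.t j) (S.t (j + 1)), φ s = χ := fun s hs => if_pos hs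
  have hφ0 : ∀ s ∉ Ioc (S.t j) (S.t (j + 1)), φ s = 0 := fun s hs => if_neg hs
  have hmono : ∀ {l m : ℕ}, l ≤ m → m ≤ S.M → S.t l ≤ S.t m := fun h hm =>
    S.strictMono.monotoneOn (by simp; omega) (by simpa using hm) h
  have hout : ∀ l ∈ Icc 1 S.M, l ≠ j + 1 → ∀ s ∈ Ioc (S.t (l - 1)) (S.t l), φ s = 0 :=
    fun l hl hlj s hs => hφ0 s fun hs' => by
      rcases lt_or_gt_of_ne hlj with h | h
      · have := hmono (l := l) (m := j) (by omega) (by omega)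
        linarith [hs.2, hs'.1]
      · have := hmono (l := j + 1) (m := l - 1) (by omega) (by have := hl.2; omega)
        linarith [hs.1, hs'.2]
  have hmem : ∀ l ∈ Icc 1 S.M, S.t l ∈ Ioc (S.t (l - 1)) (S.t l) := fun l hl =>
    ⟨S.strictMono (by have := hl.2; simp; omega) (by simpa using hl.2)
      (by have := hl.1; omega), le_rfl⟩
  have hpc : S.PiecewiseConst φ := fun l hl s hs => by
    by_cases hlj : l = j + 1
    · subst hlj
      rw [hφ1 s hs, hφ1 _ (hmem _ hl)]
    · rw [hout l hl hlj s hs, hout l hl hlj _ (hmem l hl)]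
  have hφj : φ (S.t (j + 1)) = χ := hφ1 _ ⟨h1, le_rfl⟩
  have hφl : ∀ l ∈ Icc 1 S.M, l ≠ j + 1 → φ (S.t l) = 0 := fun l hl hlj =>
    hout l hl hlj _ (hmem l hl)
  have h := hu.2 φ hpc
  rw [formB, integral_eq_of_support (h := fun t => formA Ω a t (u (S.t (j + 1))).1 χ.1) h2 h1.le h3
      (fun s hs => by rw [hφ1 s hs, hu.1 (j + 1) ⟨by omega, hj⟩ s hs])
      (fun s hs => by rw [hφ0 s hs]; exact formA_zero_right _),
    integral_eq_of_support (h := fun t => inner ℝ (f t) χ.1.1) h2 h1.le h3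
      (fun s hs => by rw [hφ1 s hs]) (fun s hs => by rw [hφ0 s hs]; simp)] at h
  rcases Nat.eq_zero_or_pos j with rfl | hj0
  · rw [Finset.sum_eq_zero fun l hl => by
      have hl := Finset.mem_Icc.1 hl
      rw [hφl l ⟨by omega, hl.2⟩ (by omega)]; simp] at h
    simp only [zero_add] at hφj h ⊢
    rw [hφj] at h
    simp only [if_true]
    linarith
  · rw [Finset.sum_eq_single (j + 1) (fun l hl hlj => by
        have hl := Finset.mem_Icc.1 hl
        rw [hφl l ⟨by omega, hl.2⟩ hlj]; simp)
      (fun hl => absurd (Finset.mem_Icc.2 ⟨by omega, hj⟩) hl), hφj,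
      hφl 1 ⟨le_rfl, by omega⟩ (by omega), Nat.add_sub_cancel, inner_sub_left] at h
    simp only [Submodule.coe_zero, Prod.fst_zero, inner_zero_right, add_zero] at h
    rw [if_neg hj0.ne']
    linarith

end Scheme

/-! ### Maximal regularity of the discrete solution on a given mesh -/

section Regularity

variable {d : ℕ} {Ω : Set (Pt d)} {V : Submodule ℝ (L2 Ω × L2vec Ω)} {T α B : ℝ} {η : ℝ → ℝ}
  {a : Fin d → Fin d → ℝ → Pt d → ℝ}

-- The abstract Euler estimate applies to the image of `V` in `L²(Ω)`. The jump quotient is the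
-- projected data minus the operator term, hence the factor `2` and the extra `F`.
set_option maxHeartbeats 1000000 in
theorem norm_opAvg_add_norm_jump_le [FiniteDimensional ℝ V]
    (hV : Function.Injective (valueMap V)) (ha : CoefficientAssumptions Ω T α η a) (hB : 0 ≤ B)
    (hreg : ∀ᵐ t ∂(volume.restrict (Ioc 0 T)), RegularTime Ω α B a t)
    {ρ : ℝ} (hρ : ∀ v : V, ‖v.1.1‖ ≤ ρ * ‖v.1.2‖)
    {S : TimeMesh T} {κ k₀ : ℝ} (hκ : 0 < κ) (hk₀ : 0 < k₀)
    (hk : ∀ j < S.M, k₀ ≤ S.t (j + 1) - S.t j)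
    (hr : ∀ i, i + 1 < S.M → S.t (i + 1) - S.t i ≤ κ * (S.t (i + 2) - S.t (i + 1)) ∧
      S.t (i + 2) - S.t (i + 1) ≤ κ * (S.t (i + 1) - S.t i))
    {f : ℝ → L2 Ω} {F : ℝ} (hf : ∀ᵐ t ∂(volume.restrict (Ioc 0 T)), ‖f t‖ ≤ F)
    {u₀ : L2 Ω} {u : ℝ → V} (hu : IsDiscreteSolution V a S f u₀ u)
    {U : ℝ} (hU : ∀ j < S.M, ‖(opAvg V a S (j + 1) (projL2 V u₀)).1.1‖ ≤ U) {Q : ℝ}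
    (hQ : Q = (2 * κ + 2) * (d ^ 2 / α) * ∫ s in Ioc 0 T, η s / s ^ (3 / 2 : ℝ))
    {j : ℕ} (hj : j < S.M) :
    ‖(opAvg V a S (j + 1) (u (S.t (j + 1)))).1.1‖
        + ‖((S.step (j + 1))⁻¹ • jump V S u₀ u (j + 1)).1.1‖
      ≤ 2 * (2 * (1 + Real.log (T / k₀)) * F + 2 * U + Q * (Q + 1) * (ρ ^ 2 / α * U + T * F))
        + F := by
  classical
  set A : ℕ → LinearMap.range (valueMap V) →ₗ[ℝ] LinearMap.range (valueMap V) :=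
    fun j => if hj : j < S.M then avgOp hV ha hB hreg S hj else 0 with hAdef
  have hA : ∀ j (hj : j < S.M), A j = avgOp hV ha hB hreg S hj := fun j hj => dif_pos hj
  -- The value of `u` at `t_0 = 0` lies in no step interval and is unconstrained, so the sequence
  -- starts from `P_h u_0` instead.
  set w : ℕ → LinearMap.range (valueMap V) :=
    fun j => if j = 0 then valueEquiv hV (projL2 V u₀) else valueEquiv hV (u (S.t j)) with hw
  have hw0 : w 0 = valueEquiv hV (projL2 V u₀) := if_pos rfl
  have hws : ∀ j, w (j + 1) = valueEquiv hV (u (S.t (j + 1))) := fun j => if_neg (by omega)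
  -- Defined as the source that makes the Euler step hold identically; the discrete problem then
  -- identifies it as the `L²` projection of the average of `f`.
  set g : ℕ → LinearMap.range (valueMap V) :=
    fun j => (S.t (j + 1) - S.t j)⁻¹ • (w (j + 1) - w j) + A j (w (j + 1)) with hg
  have hα := ha.alpha_pos
  have ht : ∀ j < S.M, S.t j < S.t (j + 1) := fun j hj => (S.interval_subset hj).1
  have hinner_w : ∀ j < S.M, ∀ χ : V, ⟪w j, valueEquiv hV χ⟫
      = if j = 0 then ⟪u₀, χ.1.1⟫ else ⟪(u (S.t j)).1.1, χ.1.1⟫ := fun j _ χ => by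
    by_cases h : j = 0
    · subst h
      rw [hw0, inner_valueEquiv, inner_projL2 hV, if_pos rfl]
    · simp only [hw, if_neg h]
      rfl
  have hinner_g : ∀ j < S.M, ∀ χ : V, ⟪g j, valueEquiv hV χ⟫
      = (S.t (j + 1) - S.t j)⁻¹ * ∫ t in (S.t j)..(S.t (j + 1)), ⟪f t, χ.1.1⟫ := fun j hj χ => by
    have h1 := hu.step_eq hj χ
    rw [← hinner_w j hj χ] at h1
    rw [← h1]
    simp only [hg]
    rw [inner_add_left, inner_smul_valueEquiv, inner_sub_left, hA j hj, hws, inner_avgOp,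
      inner_valueEquiv]
    ring
  have hgF : ∀ j < S.M, ‖g j‖ ≤ F := fun j hj => by
    obtain ⟨h1, h2, h3⟩ := S.interval_subset hj
    have hk := sub_pos.2 h1
    -- Testing `g j` with itself bounds it by `F`. If it vanishes, `0 ≤ F` must still be shown, from
    -- a time at which `‖f t‖ ≤ F`.
    obtain ⟨χ, hχ⟩ := (valueEquiv hV).surjective (g j)
    have h4 : ‖g j‖ ^ 2 ≤ F * ‖g j‖ := by
      have hn : ‖χ.1.1‖ = ‖g j‖ := by rw [← hχ, norm_valueEquiv]
      have h5 := hinner_g j hj χ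
      rw [hχ, real_inner_self_eq_norm_sq] at h5
      have h6 : ‖∫ t in (S.t j)..(S.t (j + 1)), ⟪f t, χ.1.1⟫‖
          ≤ (F * ‖g j‖) * |S.t (j + 1) - S.t j| := by
        refine intervalIntegral.norm_integral_le_of_norm_le_const_ae ?_
        rw [uIoc_of_le h1.le]
        refine (ae_restrict_iff' measurableSet_Ioc).1 ?_
        filter_upwards [ae_restrict_of_ae_restrict_of_subset (Ioc_subset_Ioc h2 h3) hf] with t ht
        refine (norm_inner_le_norm _ _).trans ?_
        rw [hn]
        exact mul_le_mul_of_nonneg_right ht (norm_nonneg _)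
      rw [h5, inv_mul_le_iff₀ hk, mul_comm]
      rw [abs_of_pos hk] at h6
      exact (le_abs_self _).trans h6
    rcases (norm_nonneg (g j)).eq_or_lt with h | h
    · have h0 : ∃ t, ‖f t‖ ≤ F := by
        have hne : (ae (volume.restrict (Ioc (S.t j) (S.t (j + 1))))).NeBot := by
          rw [ae_neBot, Ne, Measure.restrict_eq_zero, Real.volume_Ioc]
          simpa using h1
        exact (ae_restrict_of_ae_restrict_of_subset (Ioc_subset_Ioc h2 h3) hf).exists
      obtain ⟨t, ht⟩ := h0
      rw [← h]
      exact (norm_nonneg _).trans ht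
    · rw [sq] at h4
      exact le_of_mul_le_mul_right h4 h
  have hstep : ∀ j < S.M, w (j + 1) + (S.t (j + 1) - S.t j) • A j (w (j + 1))
      = w j + (S.t (j + 1) - S.t j) • g j := fun j hj => by
    have hk := sub_pos.2 (ht j hj)
    simp only [hg]
    rw [smul_add, smul_smul, mul_inv_cancel₀ hk.ne', one_smul]
    abel
  have hlow : ∀ j < S.M, ∀ v : V, α * ‖v.1.2‖ ^ 2 ≤ ⟪A j (valueEquiv hV v), valueEquiv hV v⟫ :=
    fun j hj v => by rw [hA j hj]; exact le_inner_avgOp hV ha hB hreg S hj v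
  have hpos : ∀ j < S.M, ∀ x, 0 ≤ ⟪A j x, x⟫ := fun j hj x => by
    obtain ⟨v, rfl⟩ := (valueEquiv hV).surjective x
    exact le_trans (by positivity) (hlow j hj v)
  have hη0 : ∀ i n, i < n → n < S.M → 0 ≤ η (S.t (n + 1) - S.t i) := fun i n hin hn => by
    have h1 := S.strictMono (a := i) (b := n + 1) (by simp; omega) (by simp; omega) (by omega)
    exact ha.eta_nonneg _ ⟨by linarith, by
      linarith [(S.interval_subset hn).2.2, (S.interval_subset (hin.trans hn)).2.1]⟩
  have hbound := norm_op_euler_le (A := A) (u := w) (f := g) (t := S.t) (T := T)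
    (Cp := ρ ^ 2 / α) (L := d ^ 2 / α) (F := F) (U := U) hκ (by positivity) (by positivity) hk₀
    ht S.t_zero S.t_last hk hr ha.eta_nonneg ha.eta_div_antitone ha.eta_div_integrable
    (fun j hj => by rw [hA j hj]; exact isSymmetric_avgOp hV ha hB hreg S hj)
    (fun j hj x => by
      obtain ⟨v, rfl⟩ := (valueEquiv hV).surjective x
      rw [norm_valueEquiv, div_mul_eq_mul_div, le_div_iff₀ hα]
      calc ‖v.1.1‖ ^ 2 * α ≤ (ρ * ‖v.1.2‖) ^ 2 * α :=
            mul_le_mul_of_nonneg_right (pow_le_pow_left₀ (norm_nonneg _) (hρ v) 2) hα.le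
        _ = ρ ^ 2 * (α * ‖v.1.2‖ ^ 2) := by ring
        _ ≤ _ := mul_le_mul_of_nonneg_left (hlow j hj v) (sq_nonneg ρ))
    hpos
    (fun i n hin hn x y => by
      obtain ⟨v, rfl⟩ := (valueEquiv hV).surjective x
      obtain ⟨z, rfl⟩ := (valueEquiv hV).surjective y
      have h1 := abs_inner_avgOp_sub_le hV ha hB hreg S hin hn v z
      rw [← hA n hn, ← hA i (hin.trans hn), ← inner_sub_left] at h1
      have h2 := hη0 i n hin hn
      have h3 := hlow i (hin.trans hn) v
      have h4 := hlow n hn z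
      have h5 : (α * ‖v.1.2‖ ^ 2) * (α * ‖z.1.2‖ ^ 2) ≤ _ :=
        mul_le_mul h3 h4 (by positivity) (hpos i (hin.trans hn) _)
      calc _ = |⟪A n (valueEquiv hV v) - A i (valueEquiv hV v), valueEquiv hV z⟫| ^ 2 :=
            (sq_abs _).symm
        _ ≤ (d ^ 2 * η (S.t (n + 1) - S.t i) * (‖v.1.2‖ * ‖z.1.2‖)) ^ 2 :=
            pow_le_pow_left₀ (abs_nonneg _) h1 2
        _ = (d ^ 2 / α * η (S.t (n + 1) - S.t i)) ^ 2
              * ((α * ‖v.1.2‖ ^ 2) * (α * ‖z.1.2‖ ^ 2)) := by field_simp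
        _ ≤ _ := mul_le_mul_of_nonneg_left h5 (sq_nonneg _))
    hstep hgF
    (fun j hj => by
      rw [hA j hj, hw0, avgOp_valueEquiv, norm_valueEquiv]
      exact hU j hj) hQ hj
  have hop : ‖A j (w (j + 1))‖ = ‖(opAvg V a S (j + 1) (u (S.t (j + 1)))).1.1‖ := by
    rw [hA j hj, hws, avgOp_valueEquiv, norm_valueEquiv]
  have hjump : valueEquiv hV ((S.step (j + 1))⁻¹ • jump V S u₀ u (j + 1))
      = g j - A j (w (j + 1)) := by
    simp only [hg]
    rw [add_sub_cancel_right, map_smul, jump, map_sub, TimeMesh.step, Nat.add_sub_cancel, hws]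
    congr 2
    by_cases h : j = 0
    · subst h; rw [hw0, if_pos rfl]
    · rw [if_neg (by omega)]; simp only [hw, if_neg h]
  have hjn : ‖((S.step (j + 1))⁻¹ • jump V S u₀ u (j + 1)).1.1‖ ≤ F + ‖A j (w (j + 1))‖ := by
    rw [← norm_valueEquiv hV, hjump]
    exact (norm_sub_le _ _).trans (add_le_add (hgF j hj) le_rfl)
  rw [← hop]
  linarith

end Regularity

/-! ### Time meshes -/

namespace TimeMesh

variable {T : ℝ}

theorem M_pos (S : TimeMesh T) (hT : 0 < T) : 0 < S.M := by
  rcases Nat.eq_zero_or_pos S.M with h | h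
  · have h1 := S.t_last
    rw [h, S.t_zero] at h1
    linarith
  · exact h

theorem step_succ (S : TimeMesh T) (j : ℕ) : S.step (j + 1) = S.t (j + 1) - S.t j := rfl

theorem step_le_kmax (S : TimeMesh T) {j : ℕ} (hj : j < S.M) : S.t (j + 1) - S.t j ≤ S.kmax :=
  le_ciSup (f := fun m : Icc 1 S.M => S.step m) (Set.finite_range _).bddAbove
    ⟨j + 1, by omega, hj⟩

theorem kmin_le_step (S : TimeMesh T) {j : ℕ} (hj : j < S.M) : S.kmin ≤ S.t (j + 1) - S.t j :=
  ciInf_le (f := fun m : Icc 1 S.M => S.step m) (Set.finite_range _).bddBelow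
    ⟨j + 1, by omega, hj⟩

theorem kmax_pos (S : TimeMesh T) (hT : 0 < T) : 0 < S.kmax :=
  (sub_pos.2 (S.interval_subset (S.M_pos hT)).1).trans_le (S.step_le_kmax (S.M_pos hT))

theorem Admissible.step_ratio {S : TimeMesh T} {c β κ : ℝ} (h : S.Admissible c β κ) (hκ : 0 < κ)
    {i : ℕ} (hi : i + 1 < S.M) : S.t (i + 1) - S.t i ≤ κ * (S.t (i + 2) - S.t (i + 1)) ∧
      S.t (i + 2) - S.t (i + 1) ≤ κ * (S.t (i + 1) - S.t i) := by
  obtain ⟨h1, h2⟩ := h.ratio (i + 1) (by omega) (by omega)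
  rw [step_succ, step_succ] at h1 h2
  have h3 := sub_pos.2 (S.interval_subset hi).1
  constructor
  · exact (div_le_iff₀ h3).1 h2
  · rw [le_div_iff₀ h3, inv_mul_le_iff₀ hκ] at h1
    exact h1

theorem one_le_log_div (S : TimeMesh T) (hT : 0 < T) (h : S.kmax ≤ T / 4) :
    1 ≤ Real.log (T / S.kmax) := by
  have hk := S.kmax_pos hT
  have h1 : (4 : ℝ) ≤ T / S.kmax := by
    rw [le_div_iff₀ hk]; linarith
  rw [Real.le_log_iff_exp_le (by positivity)]
  linarith [Real.exp_one_lt_three]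

/-- Since `log (T / (c k^β))` is a constant plus `β log (T / k)`, the constant is absorbed once `log
(T / k) ≥ 1`. This is how the lower bound on the steps yields a logarithm in `k` alone. -/
theorem log_div_le (S : TimeMesh T) (hT : 0 < T) {c : ℝ} (hc : 0 < c) (β : ℝ)
    (h : 1 ≤ Real.log (T / S.kmax)) : Real.log (T / (c * S.kmax ^ β))
      ≤ (|Real.log T - Real.log c - β * Real.log T| + β) * Real.log (T / S.kmax) := by
  have hk := S.kmax_pos hT
  have e1 : Real.log (T / (c * S.kmax ^ β))
      = (Real.log T - Real.log c - β * Real.log T) + β * Real.log (T / S.kmax) := by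
    rw [Real.log_div hT.ne' (by positivity), Real.log_mul hc.ne' (by positivity),
      Real.log_rpow hk, Real.log_div hT.ne' hk.ne']
    ring
  have h2 := mul_le_mul_of_nonneg_left h
    (abs_nonneg (Real.log T - Real.log c - β * Real.log T))
  rw [e1, add_mul]
  linarith [le_abs_self (Real.log T - Real.log c - β * Real.log T)]

end TimeMesh

end ParabolicFEM

end

/-! ### The theorem: uniform constants -/

open ParabolicFEM in
theorem theorem3p4 {d : ℕ} (hd : 1 ≤ d) (Ω : Set (Pt d)) (hΩ : IsOpen Ω)
    (hΩb : Bornology.IsBounded Ω) (T : ℝ) (hT : 0 < T) (α : ℝ) (η : ℝ → ℝ)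
    (a : Fin d → Fin d → ℝ → Pt d → ℝ) (ha : CoefficientAssumptions Ω T α η a)
    (c β κ : ℝ) (hc : 0 < c) (hβ : 0 < β) (hκ : 0 < κ) :
    ∃ μ > 0, ∃ δ₀ > 0, ∃ C > 0,
      ∀ S : TimeMesh T, S.Admissible c β κ → S.kmax - S.kmin ≤ δ₀ →
      ∀ K : Geometry.SimplicialComplex ℝ (Pt d), IsTriangulation Ω K →
      ∀ r : ℕ, 1 ≤ r →
      ∀ (f : Lp (L2 Ω) ∞ (volume.restrict (Ioo 0 T))) (u₀ : L2 Ω) (u : ℝ → femSpace Ω K r),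
        IsDiscreteSolution (femSpace Ω K r) a S f u₀ u →
        (⨆ m : Icc 1 S.M,
            (‖(opAvg (femSpace Ω K r) a S m (u (S.t m))).1.1‖
              + ‖((S.step m)⁻¹ • jump (femSpace Ω K r) S u₀ u m).1.1‖))
          ≤ C * Real.exp (μ * T) *
            (Real.log (T / S.kmax) * ‖f‖
              + μ * T * ⨆ m : Icc 1 S.M,
                  ‖(opAvg (femSpace Ω K r) a S m (projL2 (femSpace Ω K r) u₀)).1.1‖) := by
  have hα := ha.alpha_pos
  obtain ⟨B, hB, hreg⟩ := ha.ae_regularTime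
  obtain ⟨R, hR0, hR⟩ : ∃ R, 0 ≤ R ∧ ∀ x ∈ Ω, ‖x‖ ≤ R := by
    obtain ⟨R, hR0, hR⟩ := hΩb.exists_pos_norm_le
    exact ⟨R, hR0.le, hR⟩
  set Q := (2 * κ + 2) * (d ^ 2 / α) * ∫ s in Ioc 0 T, η s / s ^ (3 / 2 : ℝ) with hQ
  have hQ0 : 0 ≤ Q := by
    have := setIntegral_nonneg (μ := volume) measurableSet_Ioc
      (f := fun s => η s / s ^ (3 / 2 : ℝ)) fun s (hs : s ∈ Ioc 0 T) =>
        div_nonneg (ha.eta_nonneg s (Ioc_subset_Icc_self hs)) (Real.rpow_nonneg hs.1.le _)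
    positivity
  set D := |Real.log T - Real.log c - β * Real.log T| + β with hD
  set CF := 4 * (1 + D) + 2 * (Q * (Q + 1)) * T + 1 with hCF
  set CU := 4 + 2 * (Q * (Q + 1)) * ((2 * R) ^ 2 / α) with hCU
  have hD0 : 0 ≤ D := by positivity
  have hCF0 : 0 < CF := by positivity
  have hCU0 : 0 < CU := by positivity
  -- `CF` collects the coefficients of `log (T / k) ‖f‖`, and `CU` those of the initial term. That
  -- term carries the factor `μ T = T` on the right, hence `CU / T`. The exponential is only used
  -- through `exp (μ T) ≥ 1`.
  refine ⟨1, one_pos, 1, one_pos, CF + CU / T, by positivity, ?_⟩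
  intro S hS _ K hK r _ f u₀ u hu
  have hfin := finiteDimensional_femSpace hΩ hK r
  have hV : Function.Injective (valueMap (femSpace Ω K r)) := by
    rw [← LinearMap.ker_eq_bot, LinearMap.ker_eq_bot']
    intro v hv
    exact Subtype.ext (Prod.ext hv (snd_eq_zero_of_mem_H10 hΩ v.2.1 hv))
  set ℓ := Real.log (T / S.kmax) with hℓ
  have hℓ1 : 1 ≤ ℓ := S.one_le_log_div hT hS.kmax_le
  set U := ⨆ m : Icc 1 S.M,
    ‖(opAvg (femSpace Ω K r) a S m (projL2 (femSpace Ω K r) u₀)).1.1‖ with hU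
  have hUj : ∀ j < S.M,
      ‖(opAvg (femSpace Ω K r) a S (j + 1) (projL2 (femSpace Ω K r) u₀)).1.1‖ ≤ U := fun j hj =>
    le_ciSup (f := fun m : Icc 1 S.M =>
      ‖(opAvg (femSpace Ω K r) a S m (projL2 (femSpace Ω K r) u₀)).1.1‖)
      (Set.finite_range _).bddAbove ⟨j + 1, by omega, hj⟩
  have hM := S.M_pos hT
  have hU0 : 0 ≤ U := (norm_nonneg _).trans (hUj 0 hM)
  have hF0 : 0 ≤ ‖f‖ := norm_nonneg f
  have hf : ∀ᵐ t ∂(volume.restrict (Ioc 0 T)), ‖f t‖ ≤ ‖f‖ := by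
    rw [← restrict_Ioo_eq_restrict_Ioc, Lp.norm_def, toReal_eLpNorm (Lp.aestronglyMeasurable f)]
    exact ae_le_lpNorm_exponent_top (Lp.memLp f)
  have hk₀ : 0 < c * S.kmax ^ β := mul_pos hc (Real.rpow_pos_of_pos (S.kmax_pos hT) _)
  have hlog : Real.log (T / (c * S.kmax ^ β)) ≤ D * ℓ := S.log_div_le hT hc β hℓ1
  have : Nonempty (Icc 1 S.M) := ⟨⟨1, le_rfl, hM⟩⟩
  refine ciSup_le fun m => ?_
  obtain ⟨m, hm1, hmM⟩ := m
  obtain ⟨j, rfl⟩ : ∃ j, m = j + 1 := ⟨m - 1, by omega⟩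
  refine (norm_opAvg_add_norm_jump_le hV ha hB hreg (ρ := 2 * R)
    (fun v => norm_le_of_mem_H10 hd hR0 hR v.2.1) hκ hk₀
    (fun j hj => hS.kmin_ge.trans (S.kmin_le_step hj)) (fun i hi => hS.step_ratio hκ hi) hf hu hUj
    hQ hmM).trans ?_
  have hQQ : 0 ≤ Q * (Q + 1) := by positivity
  have hFℓ : ‖f‖ ≤ ℓ * ‖f‖ := le_mul_of_one_le_left hF0 hℓ1
  have h1 : Real.log (T / (c * S.kmax ^ β)) * ‖f‖ ≤ D * ℓ * ‖f‖ :=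
    mul_le_mul_of_nonneg_right hlog hF0
  have h2 : Q * (Q + 1) * T * ‖f‖ ≤ Q * (Q + 1) * T * (ℓ * ‖f‖) :=
    mul_le_mul_of_nonneg_left hFℓ (by positivity)
  have hexp : 1 ≤ Real.exp (1 * T) := Real.one_le_exp (by linarith)
  calc _ ≤ CF * (ℓ * ‖f‖) + CU * U := by
        rw [hCF, hCU]
        linarith
    _ ≤ (CF + CU / T) * (ℓ * ‖f‖ + 1 * T * U) := by
        have h3 : CU / T * (1 * T * U) = CU * U := by field_simp
        have h4 : 0 ≤ CU / T * (ℓ * ‖f‖) := by positivity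
        have h5 : 0 ≤ CF * (1 * T * U) := by positivity
        linarith
    _ ≤ (CF + CU / T) * Real.exp (1 * T) * (ℓ * ‖f‖ + 1 * T * U) := by
        refine mul_le_mul_of_nonneg_right ?_ (by positivity)
        exact le_mul_of_one_le_right (by positivity) hexp
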